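/- Let $q_0$ be a power of a prime $p$, let $m,\ell,s\ge 1$ be integers, $q=q_0^s$, $n=\ell m$ and $\mathbb F=\mathbb F_{q_0^m}$. Assume that $p\nmid\ell$ and that $\mathbb F_q$ contains all roots of $x^\ell-1$. Regard $\mathbb F$ and $\mathbb F_q$ as subfields of $\mathbb F_{q^m}$, and let $\sigma(a)=a^q$, on $\mathbb F_{q^m}$ and on $\mathbb F$. Put $\mathcal S=\mathbb F[x]/(x^\ell-1)$, extend $\sigma$ to $\mathcal S$ by $\sigma(x)=x$, and let $\mathcal R=\mathcal S[z;\sigma]/(z^m-1)$, where $\mathcal S[z;\sigma]$ is the skew polynomial ring with $za=\sigma(a)z$. Write $\mathbf c\in\mathbb F^n$ as $(\mathbf c^{(0)},\dots,\mathbf c^{(\ell-1)})$ with $\mathbf c^{(i)}=(c^{(i)}_0,\dots,c^{(i)}_{m-1})\in\mathbb F^m$. A cyclic-skew-cyclic (CSC) code is an $\mathbb F$-linear subspace $\mathcal C\subseteq\mathbb F^n$ stable under $(\mathbf c^{(0)},\dots,\mathbf c^{(\ell-1)})\mapsto(\mathbf c^{(\ell-1)},\mathbf c^{(0)},\dots,\mathbf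 c^{(\ell-2)})$ and under the map that applies $(c_0,\dots,c_{m-1})\mapsto(\sigma(c_{m-1}),\sigma(c_0),\dots,\sigma(c_{m-2}))$ to every block. It is identified with its image in $\mathcal R$ under $\mathbf c\mapsto\sum_{j}\bigl(\sum_i c^{(i)}_j x^i\bigr)z^j$. A minimal generator skew polynomial of $\mathcal C$ is an element $g\in\mathcal S[z;\sigma]$ such that $\mathcal C$ is the left ideal of $\mathcal R$ generated by $g$ and there is $h\in\mathcal S[z;\sigma]$ with $gh=hg=z^m-1$ in $\mathcal S[z;\sigma]$, where moreover, for every irreducible factor $P$ of $x^\ell-1$ in $\mathbb F[x]$, the images of $g$ and $h$ with coefficients in $\mathbb F[x]/(P)$ are monic in $z$. **Theorem.** Let $\mathcal C$ be a CSC code. Then $\mathcal C$ has a unique minimal generator skew polynomial $g=g(x,z)$. For $a\in\mathbb F_q$ with $a^\ell=1$, let $g(a,z)\in\mathbb F_{q^m}[z;\sigma]$ be obtained by evaluating the coefficients of $g$ at $x=a$, and let $$T_{\mathcal C}(a)=\{\beta\in\mathbb F_{q^m}\setminus\{0\} : g(a,z)\text{ lies in the left ideal of }\mathbb F_{q^m}[z;\sigma]\text{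 generated by } z-\sigma(\beta)\beta^{-1}\}.$$ Then $T_{\mathcal C}(a)\cup\{0\}$ is an $\mathbb F_q$-linear subspace of $\mathbb F_{q^m}$ for every such $a$. Moreover, if $x^\ell-1=m_1(x)\cdots m_t(x)$ with irreducible $m_i\in\mathbb F[x]$, and $a_1,\dots,a_t\in\mathbb F_q$ are such that $m_i(a_i)=0$ for all $i$, then $$\dim_{\mathbb F}\mathcal C=\sum_{i=1}^t\deg(m_i)\bigl(m-\dim_{\mathbb F_q}(T_{\mathcal C}(a_i)\cup\{0\})\bigr)=n-\sum_{i=1}^t\deg(m_i)\dim_{\mathbb F_q}(T_{\mathcal C}(a_i)\cup\{0\}).$$ -/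

import Mathlib

open Polynomial

noncomputable section

namespace CSC

/-- A copy of the ring `R`, on which the variable of a skew polynomial ring acts through the
ring endomorphism `σ`. -/
def Twist {R : Type*} [CommRing R] (_σ : R →+* R) : Type _ := R

section Twist

variable {R : Type*} [CommRing R]

instance (σ : R →+* R) : CommRing (Twist σ) := inferInstanceAs (CommRing R)

/-- The identity map `R → Twist σ`. -/
def toTwist (σ : R →+* R) : R ≃+* Twist σ := RingEquiv.refl R

/-- `z ^ k` acts on the coefficients as the `k`-th iterate of `σ`. -/
instance (σ : R →+* R) : MulSemiringAction (Multiplicative ℕ) (Twist σ) :=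
  letI : MulSemiringAction (R →+* R) (Twist σ) := inferInstanceAs (MulSemiringAction (R →+* R) R)
  MulSemiringAction.compHom (Twist σ) (powersHom (R →+* R) σ)

/-- The skew polynomial ring `R[z; σ]`, in which `z a = σ(a) z`. -/
abbrev SkewPoly (σ : R →+* R) : Type _ := SkewPolynomial (Twist σ)

/-- The monomial `r z ^ k`. -/
def mono (σ : R →+* R) (k : ℕ) (r : R) : SkewPoly σ :=
  SkewPolynomial.monomial k (toTwist σ r)

/-- The `k`-th coefficient of a skew polynomial. -/
def coef {σ : R →+* R} (f : SkewPoly σ) (k : ℕ) : R :=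
  (toTwist σ).symm (SkewPolynomial.coeff f k)

/-- The commutation rule `z a = σ(a) z`. -/
theorem mono_one_mul_mono_zero (σ : R →+* R) (a : R) :
    mono σ 1 1 * mono σ 0 a = mono σ 0 (σ a) * mono σ 1 1 := by
  simp only [mono, SkewPolynomial.monomial_mul_monomial]
  change SkewPolynomial.monomial 1 ((1 : R) * σ a : R) = SkewPolynomial.monomial 1 (σ a * (1 : R) : R)
  rw [one_mul, mul_one]

/-- The skew polynomial `z ^ m - 1`. -/
def zPowSubOne (σ : R →+* R) (m : ℕ) : SkewPoly σ := mono σ m 1 - 1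

end Twist

section Rings

variable {F : Type*} [Field F]

/-- The commutative ring `S = F[x] / (x ^ ℓ - 1)`. -/
abbrev S (F : Type*) [Field F] (ℓ : ℕ) : Type _ := AdjoinRoot (X ^ ℓ - 1 : F[X])

/-- The extension of `σ` to `S` that fixes `x`. -/
def extend (σ : F →+* F) (ℓ : ℕ) : S F ℓ →+* S F ℓ :=
  AdjoinRoot.map σ (X ^ ℓ - 1) (X ^ ℓ - 1) (by simp)

/-- The skew polynomial ring `S[z; σ]`. -/
abbrev SkewS (σ : F →+* F) (ℓ : ℕ) : Type _ := SkewPoly (extend σ ℓ)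

/-- The ring `S[z; σ] / (z ^ m - 1)`. If the `m`-th iterate of `σ` is the identity, then
`z ^ m - 1` is central, and the two-sided ideal that it generates is the left ideal that it
generates. -/
abbrev RingR (σ : F →+* F) (ℓ m : ℕ) : Type _ :=
  (TwoSidedIdeal.span {zPowSubOne (extend σ ℓ) m}).ringCon.Quotient

/-- The projection of `S[z; σ]` onto `S[z; σ] / (z ^ m - 1)`. -/
def toR (σ : F →+* F) (ℓ m : ℕ) : SkewS σ ℓ →+* RingR σ ℓ m :=
  (TwoSidedIdeal.span {zPowSubOne (extend σ ℓ) m}).ringCon.mk'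

end Rings

section Codes

variable {F : Type*} [Field F] {ℓ m : ℕ}

/-- The cyclic inter-block shift
`(c⁽⁰⁾, …, c⁽ˡ⁻¹⁾) ↦ (c⁽ˡ⁻¹⁾, c⁽⁰⁾, …, c⁽ˡ⁻²⁾)`. -/
def interShift (c : Fin ℓ → Fin m → F) : Fin ℓ → Fin m → F :=
  fun i => c ((finRotate ℓ).symm i)

/-- The skew-cyclic intra-block shift, which applies
`(c₀, …, c_{m-1}) ↦ (σ(c_{m-1}), σ(c₀), …, σ(c_{m-2}))` to every block. -/
def intraShift (σ : F →+* F) (c : Fin ℓ → Fin m → F) : Fin ℓ → Fin m → F :=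
  fun i j => σ (c i ((finRotate m).symm j))

/-- A linear code in `F ^ n`, where `n = ℓ m`, is cyclic-skew-cyclic if it is stable under both
shifts. -/
def IsCSC (σ : F →+* F) (C : Submodule F (Fin ℓ → Fin m → F)) : Prop :=
  (∀ c ∈ C, interShift c ∈ C) ∧ (∀ c ∈ C, intraShift σ c ∈ C)

/-- The identification
`c ↦ ∑ j, (∑ i, c⁽ⁱ⁾_j x ^ i) z ^ j` of `F ^ n` with `S[z; σ] / (z ^ m - 1)`. -/
def nu (σ : F →+* F) (c : Fin ℓ → Fin m → F) : RingR σ ℓ m :=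
  toR σ ℓ m (∑ j : Fin m, mono (extend σ ℓ) j
    (∑ i : Fin ℓ, AdjoinRoot.mk (X ^ ℓ - 1) (C (c i j) * X ^ (i : ℕ))))

/-- For a divisor `P` of `x ^ ℓ - 1`, the image of the skew polynomial `f` over `F[x] / (P)` is
monic in `z`. -/
def IsMonicMod {σ : F →+* F} (P : F[X]) (hP : P ∣ X ^ ℓ - 1) (f : SkewS σ ℓ) : Prop :=
  ∃ d : ℕ, AdjoinRoot.algHomOfDvd F (X ^ ℓ - 1) P hP (coef f d) = 1 ∧
    ∀ k, d < k → AdjoinRoot.algHomOfDvd F (X ^ ℓ - 1) P hP (coef f k) = 0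

/-- `g` is the minimal generator, and `h` the minimal check skew polynomial, of the code `C`: for
every irreducible factor `P` of `x ^ ℓ - 1` in `F[x]` their images over `F[x] / (P)` are monic in
`z`, the code is the left ideal generated by `g`, and `g h = h g = z ^ m - 1` in `S[z; σ]`. -/
structure IsMinimalPair (σ : F →+* F) (C : Submodule F (Fin ℓ → Fin m → F))
    (g h : SkewS σ ℓ) : Prop where
  monic_left : ∀ (P : F[X]) (hP : P ∣ X ^ ℓ - 1), Irreducible P → IsMonicMod P hP g
  monic_right : ∀ (P : F[X]) (hP : P ∣ X ^ ℓ - 1), Irreducible P → IsMonicMod P hP h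
  generates : nu σ '' (C : Set (Fin ℓ → Fin m → F)) =
    (Ideal.span {toR σ ℓ m g} : Ideal (RingR σ ℓ m))
  mul_left : g * h = zPowSubOne (extend σ ℓ) m
  mul_right : h * g = zPowSubOne (extend σ ℓ) m

/-- `g` is a minimal generator skew polynomial of the code `C`. -/
def IsMinimalGenerator (σ : F →+* F) (C : Submodule F (Fin ℓ → Fin m → F))
    (g : SkewS σ ℓ) : Prop :=
  ∃ h, IsMinimalPair σ C g h

/-- The minimal generator skew polynomial of the code `C` (meaningful if there is a unique one). -/
def minimalGenerator (σ : F →+* F) (C : Submodule F (Fin ℓ → Fin m → F)) : SkewS σ ℓ :=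
  Classical.epsilon (IsMinimalGenerator σ C)

end Codes

section Evaluation

variable {F K E : Type*} [Field F] [Field K] [Field E] [Algebra F E] [Algebra K E] {ℓ m : ℕ}

/-- The evaluation `f(x) ↦ f(a)` from `F[x] / (x ^ ℓ - 1)` to `E`. -/
def evRoot (F E : Type*) [Field F] [Field E] [Algebra F E] [Algebra K E]
    (a : K) (ha : a ^ ℓ = 1) : S F ℓ →+* E :=
  AdjoinRoot.lift (algebraMap F E) (algebraMap K E a) (by simp [← map_pow, ha])

/-- The partial evaluation `f(x, z) ↦ f(a, z)` from `S[z; σ]` to `E[z; τ]`. -/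
def evPartial (σ : F →+* F) (τ : E →+* E) (a : K) (ha : a ^ ℓ = 1) (f : SkewS σ ℓ) : SkewPoly τ :=
  SkewPolynomial.sum f fun k r => mono τ k (evRoot F E a ha ((toTwist (extend σ ℓ)).symm r))

/-- The left ideal of `E[z; τ]` generated by `z - τ(β) β⁻¹`. -/
def rootIdeal (τ : E →+* E) (β : E) : Ideal (SkewPoly τ) :=
  Ideal.span {mono τ 1 1 - mono τ 0 (τ β * β⁻¹)}

/-- The evaluation at `1 ^ β = τ(β) β⁻¹`: the projection of `E[z; τ]` onto its quotient left module
by the left ideal generated by `z - τ(β) β⁻¹`. -/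
def evSkew (τ : E →+* E) (β : E) (f : SkewPoly τ) :
    SkewPoly τ ⧸ (rootIdeal τ β : Submodule (SkewPoly τ) (SkewPoly τ)) :=
  Submodule.Quotient.mk f

/-- The defining set of the code `C`: the pairs `(a, β)` with `a ^ ℓ = 1` and `β ≠ 0` at which the
total evaluation of the minimal generator skew polynomial of `C` is zero. -/
def definingSet (σ : F →+* F) (τ : E →+* E) (C : Submodule F (Fin ℓ → Fin m → F)) :
    Set (K × E) :=
  {x | x.2 ≠ 0 ∧ ∃ ha : x.1 ^ ℓ = 1,
    evSkew τ x.2 (evPartial σ τ x.1 ha (minimalGenerator σ C)) = 0}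

/-- The set of all nonzero `β` for which `(a, β)` lies in the defining set. -/
def definingSetAt (σ : F →+* F) (τ : E →+* E) (C : Submodule F (Fin ℓ → Fin m → F)) (a : K) :
    Set E :=
  {β | β ≠ 0 ∧ (a, β) ∈ definingSet σ τ C}

end Evaluation

end CSC

end

/-!
The polynomial `x ^ ℓ - 1` is separable, so `S = F[x] / (x ^ ℓ - 1)` is the product of the fields
`F[x] / (M i)`, where the `M i` are its irreducible factors. All roots of `x ^ ℓ - 1` lie in `K` and
are fixed by the `q`-Frobenius `τ`. Hence `σ` fixes every `M i` up to a constant factor and acts on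
each factor field separately (`dvd_map_of_root`, `rootsDecomposition`), and `S[z; σ]` is the product
of skew polynomial rings over fields (`FieldDecomposition`).

A cyclic-skew-cyclic code corresponds to a left ideal of `S[z; σ]` that contains the central element
`z ^ m - 1` (`codeIdeal`). Over a field, right division shows that such a left ideal has exactly one
monic generator (`exists_monic_generator`, `MonicOfDegree.eq_of_span_eq`). It divides `z ^ m - 1` on
the right, and, by centrality and cancellation, on the left
(`MonicOfDegree.mul_comm_of_mul_eq`). Gluing the generators over the factor fields with idempotents
gives the minimal generator `g` (`existsUnique_isMinimalGenerator`). If `d i` is the degree of `g`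
over `F[x] / (M i)`, the quotient of the ambient space by the code is the product of the spaces of
remainders, whence `dim C = ℓ m - ∑ deg (M i) * d i` (`finrank_add_sum_eq`).

It remains to recognize `d i` as the dimension of the zeros. Let `E[z; τ]` act on `E`, with `z`
acting as `τ` (`operator`). Then `f` lies in the left ideal generated by `z - τ(β) β⁻¹` if and only
if `f` annihilates `β` (`mem_rootIdeal_iff`), so the zeros together with `0` form the kernel of the
`K`-linear operator `g(a, z)`. A monic skew polynomial of degree `d` acts as a linearized polynomial
of degree `q ^ d`, so its kernel has dimension at most `d`. For complementary factors of `z ^ m - 1`,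
which acts as zero, rank-nullity turns both bounds into equalities (`finrank_ker_operator`).
Evaluation at a root `a` of `M i` factors through `F[x] / (M i)`, so `g(a, z)` is monic of degree
`d i` (`monicOfDegree_skewMap_evRoot`).
-/

noncomputable section

namespace CSC

/-! ### Coefficients, degrees and right division in `R[z; σ]` -/

section Basics

variable {R : Type*} [CommRing R] {σ : R →+* R}

theorem twist_smul (n : ℕ) (r : R) :
    Multiplicative.ofAdd n • toTwist σ r = toTwist σ (σ^[n] r) := by
  change (powersHom (R →+* R) σ (Multiplicative.ofAdd n)) r = σ^[n] r
  simp [powersHom_apply]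

theorem coef_zero (k : ℕ) : coef (0 : SkewPoly σ) k = 0 := rfl

theorem coef_add (f g : SkewPoly σ) (k : ℕ) : coef (f + g) k = coef f k + coef g k := by
  simp [coef, SkewPolynomial.coeff]

theorem coef_sub (f g : SkewPoly σ) (k : ℕ) : coef (f - g) k = coef f k - coef g k := by
  simp [coef, SkewPolynomial.coeff]

theorem coef_sum {ι : Type*} (s : Finset ι) (f : ι → SkewPoly σ) (k : ℕ) :
    coef (∑ i ∈ s, f i) k = ∑ i ∈ s, coef (f i) k := by
  classical
  induction s using Finset.induction_on with
  | empty => simp [coef_zero]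
  | insert a s ha ih => simp [Finset.sum_insert ha, coef_add, ih]

theorem coef_mono (j : ℕ) (r : R) (k : ℕ) : coef (mono σ j r) k = if j = k then r else 0 := by
  unfold coef mono
  rw [SkewPolynomial.coeff_monomial]
  split_ifs <;> simp

theorem skewPoly_ext {f g : SkewPoly σ} (h : ∀ k, coef f k = coef g k) : f = g :=
  SkewMonoidAlgebra.ext fun a => (toTwist σ).symm.injective (h a.toAdd)

theorem mono_zero (k : ℕ) : mono σ k 0 = 0 := by simp [mono]

theorem mono_add (k : ℕ) (r s : R) : mono σ k (r + s) = mono σ k r + mono σ k s := by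
  simp [mono]

theorem mono_zero_one : mono σ 0 1 = 1 := by
  simp only [mono, map_one]; rfl

theorem mono_mul_mono (j k : ℕ) (r s : R) :
    mono σ j r * mono σ k s = mono σ (j + k) (r * σ^[j] s) := by
  unfold mono
  rw [SkewPolynomial.monomial_mul_monomial, SkewPolynomial.φ_iterate_apply, twist_smul,
    map_mul (toTwist σ)]

theorem coef_one (k : ℕ) : coef (1 : SkewPoly σ) k = if 0 = k then 1 else 0 := by
  rw [← mono_zero_one, coef_mono]

@[elab_as_elim]
theorem skewPoly_induction {motive : SkewPoly σ → Prop} (f : SkewPoly σ)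
    (h_mono : ∀ k r, motive (mono σ k r))
    (h_add : ∀ f g, motive f → motive g → motive (f + g)) : motive f := by
  refine SkewPolynomial.induction f ?_ ?_
  · simpa [mono_zero] using h_mono 0 0
  · intro n r q _ _ hq
    exact h_add _ _ (h_mono n ((toTwist σ).symm r)) hq

theorem exists_coef_eq_zero (f : SkewPoly σ) : ∃ N, ∀ k, N ≤ k → coef f k = 0 := by
  induction f using skewPoly_induction with
  | h_mono k r => exact ⟨k + 1, fun j hj => by rw [coef_mono, if_neg (by omega)]⟩
  | h_add f g hf hg =>
    obtain ⟨a, ha⟩ := hf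
    obtain ⟨b, hb⟩ := hg
    exact ⟨max a b, fun k hk => by rw [coef_add, ha k (by omega), hb k (by omega), add_zero]⟩

theorem eq_sum_mono {f : SkewPoly σ} {N : ℕ} (h : ∀ k, N ≤ k → coef f k = 0) :
    f = ∑ j : Fin N, mono σ j (coef f j) := by
  refine skewPoly_ext fun k => ?_
  rw [coef_sum]
  simp only [coef_mono]
  by_cases hk : k < N
  · rw [Finset.sum_eq_single (⟨k, hk⟩ : Fin N)]
    · simp
    · intro b _ hb
      exact if_neg fun h => hb (Fin.ext h)
    · simp
  · rw [h k (by omega), Finset.sum_eq_zero]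
    intro b _
    rw [if_neg]
    omega

theorem coef_mul (f g : SkewPoly σ) (n : ℕ) :
    coef (f * g) n = ∑ x ∈ Finset.HasAntidiagonal.antidiagonal n,
      coef f x.1 * σ^[x.1] (coef g x.2) := by
  induction f using skewPoly_induction with
  | h_add f₁ f₂ h₁ h₂ => simp only [add_mul, coef_add, h₁, h₂, Finset.sum_add_distrib]
  | h_mono j r =>
    induction g using skewPoly_induction with
    | h_add f₁ f₂ h₁ h₂ =>
      simp only [mul_add, coef_add, h₁, h₂, Finset.sum_add_distrib, iterate_map_add]
    | h_mono k s =>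
      rw [mono_mul_mono, coef_mono]
      simp only [coef_mono]
      split_ifs with h
      · rw [Finset.sum_eq_single (j, k)]
        · simp
        · rintro ⟨a, b⟩ _ hab
          by_cases h1 : j = a
          · have : k ≠ b := fun h2 => hab (by rw [h1, h2])
            simp [this, iterate_map_zero]
          · simp [h1]
        · simp [h]
      · symm
        refine Finset.sum_eq_zero ?_
        rintro ⟨a, b⟩ hab
        have := Finset.HasAntidiagonal.mem_antidiagonal.1 hab
        by_cases h1 : j = a
        · have : k ≠ b := by rintro rfl; simp_all
          simp [this, iterate_map_zero]
        · simp [h1]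

theorem coef_mul_of_lt {f g : SkewPoly σ} {a b : ℕ} (hf : ∀ k, a < k → coef f k = 0)
    (hg : ∀ k, b < k → coef g k = 0) {k : ℕ} (hk : a + b < k) : coef (f * g) k = 0 := by
  rw [coef_mul]
  refine Finset.sum_eq_zero ?_
  rintro ⟨x, y⟩ hxy
  have := Finset.HasAntidiagonal.mem_antidiagonal.1 hxy
  by_cases hx : a < x
  · simp [hf x hx]
  · rw [hg y (by simp at this; omega), iterate_map_zero, mul_zero]

/-- The leading coefficient of a product. -/
theorem coef_mul_add {f g : SkewPoly σ} {a b : ℕ} (hf : ∀ k, a < k → coef f k = 0)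
    (hg : ∀ k, b < k → coef g k = 0) : coef (f * g) (a + b) = coef f a * σ^[a] (coef g b) := by
  rw [coef_mul, Finset.sum_eq_single (a, b)]
  · rintro ⟨x, y⟩ hxy hne
    have := Finset.HasAntidiagonal.mem_antidiagonal.1 hxy
    by_cases hx : a < x
    · simp [hf x hx]
    · rcases eq_or_ne x a with rfl | hxa
      · exact absurd (by rw [show y = b by simp at this; omega]) hne
      · rw [hg y (by simp at this; omega), iterate_map_zero, mul_zero]
  · simp

/-- The skew polynomial `f` is monic of degree `d`. -/
def MonicOfDegree (f : SkewPoly σ) (d : ℕ) : Prop :=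
  coef f d = 1 ∧ ∀ k, d < k → coef f k = 0

theorem exists_leading {f : SkewPoly σ} (hf : f ≠ 0) :
    ∃ N, coef f N ≠ 0 ∧ ∀ k, N < k → coef f k = 0 := by
  classical
  obtain ⟨M, hM⟩ := exists_coef_eq_zero f
  by_contra! h
  refine hf (skewPoly_ext fun k => ?_)
  have key : ∀ j k, M ≤ k + j → coef f k = 0 := by
    intro j
    induction j with
    | zero => exact fun k hk => hM k hk
    | succ j ih =>
      intro k hk
      by_contra hne
      obtain ⟨l, hl, hl'⟩ := h k hne
      exact hl' (ih l (by omega))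
  exact key M k (by omega)

/-- A nonzero left multiple of a monic skew polynomial of degree `d` has degree at least `d`. This
holds over any commutative ring, since the leading coefficient `1` is fixed by `σ`. -/
theorem MonicOfDegree.eq_zero_of_mul {f g : SkewPoly σ} {d : ℕ} (hg : MonicOfDegree g d)
    (h : ∀ k, d ≤ k → coef (f * g) k = 0) : f = 0 := by
  by_contra hf
  obtain ⟨N, hN, hN'⟩ := exists_leading hf
  have := coef_mul_add hN' hg.2
  rw [h _ (by omega), hg.1, iterate_map_one, mul_one] at this
  exact hN this.symm

/-- Right division by a monic skew polynomial. -/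
theorem MonicOfDegree.exists_remainder {g : SkewPoly σ} {d : ℕ} (hg : MonicOfDegree g d)
    (f : SkewPoly σ) : ∃ u, ∀ k, d ≤ k → coef (f - u * g) k = 0 := by
  obtain ⟨N, hN⟩ := exists_coef_eq_zero f
  obtain ⟨j, hj⟩ : ∃ j, N ≤ d + j := ⟨N, by omega⟩
  induction j generalizing f N with
  | zero => exact ⟨0, fun k hk => by simpa using hN k (by omega)⟩
  | succ j ih =>
    have hm : ∀ k, j < k → coef (mono σ j (coef f (j + d))) k = 0 := fun k hk => by
      rw [coef_mono, if_neg (by omega)]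
    obtain ⟨u, hu⟩ := ih (f - mono σ j (coef f (j + d)) * g) (d + j) (fun k hk => by
      rcases eq_or_lt_of_le hk with rfl | hk
      · rw [coef_sub, add_comm d j, coef_mul_add hm hg.2, coef_mono, if_pos rfl, hg.1,
          iterate_map_one, mul_one, sub_self]
      · rw [coef_sub, hN k (by omega), coef_mul_of_lt hm hg.2 (by omega), sub_zero]) le_rfl
    refine ⟨u + mono σ j (coef f (j + d)), fun k hk => ?_⟩
    rw [← hu k hk, add_mul, sub_sub, add_comm (u * g)]

end Basics

/-! ### The universal property -/

section Lift

variable {R : Type*} [CommRing R] {σ : R →+* R} {B : Type*} [Ring B]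

/-- The universal property of `R[z; σ]`: a ring homomorphism `φ` on the coefficients and an
element `b`, the image of `z`, that satisfies the commutation rule extend to `R[z; σ]`. -/
def skewLift (φ : R →+* B) (b : B) (h : ∀ r, b * φ r = φ (σ r) * b) : SkewPoly σ →+* B :=
  SkewMonoidAlgebra.liftNCRingHom (φ.comp (toTwist σ).symm.toRingHom) (powersHom B b) (by
    intro x y
    have key : ∀ (n : ℕ) (r : R), φ (σ^[n] r) * b ^ n = b ^ n * φ r := by
      intro n
      induction n with
      | zero => simp
      | succ n ih =>
        intro r
        rw [Function.iterate_succ_apply, pow_succ, ← mul_assoc, ih, mul_assoc, ← h, mul_assoc]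
    have h1 := twist_smul (σ := σ) y.toAdd ((toTwist σ).symm x)
    rw [ofAdd_toAdd, RingEquiv.apply_symm_apply] at h1
    rw [h1]
    exact key y.toAdd ((toTwist σ).symm x))

theorem skewLift_mono (φ : R →+* B) (b : B) (h : ∀ r, b * φ r = φ (σ r) * b) (k : ℕ) (r : R) :
    skewLift φ b h (mono σ k r) = φ r * b ^ k := by
  change SkewMonoidAlgebra.liftNC _ _ (SkewMonoidAlgebra.single _ _) = _
  rw [SkewMonoidAlgebra.liftNC_single]
  simp

end Lift

/-! ### Change of coefficients -/

section Map

variable {R R' : Type*} [CommRing R] [CommRing R'] {σ : R →+* R} {σ' : R' →+* R'}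

theorem mono_one_pow (k : ℕ) : (mono σ 1 1) ^ k = mono σ k 1 := by
  induction k with
  | zero => rw [pow_zero, mono_zero_one]
  | succ k ih => rw [pow_succ, ih, mono_mul_mono, iterate_map_one, mul_one]

/-- The constants as a ring homomorphism `R → R[z; σ]`. -/
def constHom (σ : R →+* R) : R →+* SkewPoly σ where
  toFun r := mono σ 0 r
  map_one' := mono_zero_one
  map_zero' := mono_zero 0
  map_add' := mono_add 0
  map_mul' r s := by simp [mono_mul_mono]

/-- The ring homomorphism `R[z; σ] → R'[z; σ']` that applies to the coefficients a ring
homomorphism `φ` with `σ' ∘ φ = φ ∘ σ`. -/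
def skewMap (φ : R →+* R') (h : ∀ r, σ' (φ r) = φ (σ r)) : SkewPoly σ →+* SkewPoly σ' :=
  skewLift ((constHom σ').comp φ) (mono σ' 1 1) fun r => by
    simp [constHom, mono_mul_mono, h]

variable (φ : R →+* R') (h : ∀ r, σ' (φ r) = φ (σ r))

theorem skewMap_mono (k : ℕ) (r : R) : skewMap φ h (mono σ k r) = mono σ' k (φ r) := by
  rw [skewMap, skewLift_mono, mono_one_pow]
  simp [constHom, mono_mul_mono]

theorem coef_skewMap (f : SkewPoly σ) (k : ℕ) : coef (skewMap φ h f) k = φ (coef f k) := by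
  induction f using skewPoly_induction with
  | h_mono j r => rw [skewMap_mono, coef_mono, coef_mono]; split_ifs <;> simp
  | h_add f g hf hg => rw [map_add, coef_add, coef_add, hf, hg, map_add]

theorem skewMap_zPowSubOne (m : ℕ) : skewMap φ h (zPowSubOne σ m) = zPowSubOne σ' m := by
  simp [zPowSubOne, skewMap_mono]

theorem skewMap_surjective (hφ : Function.Surjective φ) {N : ℕ} (f : SkewPoly σ')
    (hN : ∀ k, N ≤ k → coef f k = 0) :
    ∃ f', skewMap φ h f' = f ∧ ∀ k, N ≤ k → coef f' k = 0 := by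
  choose ψ hψ using hφ
  refine ⟨∑ j : Fin N, mono σ j (ψ (coef f j)), ?_, ?_⟩
  · rw [map_sum]
    simp only [skewMap_mono, hψ]
    exact (eq_sum_mono hN).symm
  · intro k hk
    rw [coef_sum]
    exact Finset.sum_eq_zero fun j _ => by rw [coef_mono, if_neg (by omega)]

end Map

/-! ### The central element `z ^ m - 1` -/

section Central

variable {R : Type*} [CommRing R] {σ : R →+* R} {m : ℕ}

theorem zPowSubOne_comm (hσ : ∀ r, σ^[m] r = r) (f : SkewPoly σ) :
    zPowSubOne σ m * f = f * zPowSubOne σ m := by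
  induction f using skewPoly_induction with
  | h_mono j r =>
    simp [zPowSubOne, sub_mul, mul_sub, mono_mul_mono, hσ, add_comm j m, iterate_map_one]
  | h_add f g hf hg => rw [mul_add, add_mul, hf, hg]

theorem monicOfDegree_zPowSubOne (hm : 0 < m) : MonicOfDegree (zPowSubOne σ m) m := by
  constructor
  · simp [zPowSubOne, coef_sub, coef_mono, coef_one, hm.ne]
  · intro k hk
    simp [zPowSubOne, coef_sub, coef_mono, coef_one, hk.ne, (hm.trans hk).ne]

/-- As `z ^ m - 1` is central, its left multiples form a two-sided ideal. -/
theorem mem_span_zPowSubOne_iff (hσ : ∀ r, σ^[m] r = r) (f : SkewPoly σ) :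
    f ∈ TwoSidedIdeal.span {zPowSubOne σ m} ↔ ∃ u, f = u * zPowSubOne σ m := by
  constructor
  · intro hf
    let I : TwoSidedIdeal (SkewPoly σ) := TwoSidedIdeal.mk'
      {f | ∃ u, f = u * zPowSubOne σ m} ⟨0, by simp⟩
      (by rintro _ _ ⟨u, rfl⟩ ⟨v, rfl⟩; exact ⟨u + v, by rw [add_mul]⟩)
      (by rintro _ ⟨u, rfl⟩; exact ⟨-u, by rw [neg_mul]⟩)
      (by rintro x _ ⟨u, rfl⟩; exact ⟨x * u, by rw [mul_assoc]⟩)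
      (by
        rintro _ y ⟨u, rfl⟩
        exact ⟨u * y, by rw [mul_assoc, zPowSubOne_comm hσ, mul_assoc]⟩)
    have hI : f ∈ I := (TwoSidedIdeal.mem_span_iff.1 hf) I (by
      rintro x rfl
      exact (TwoSidedIdeal.mem_mk' _ _ _ _ _ _ _).2 ⟨1, by rw [one_mul]⟩)
    simpa only [I, TwoSidedIdeal.mem_mk', Set.mem_ofPred_eq] using hI
  · rintro ⟨u, rfl⟩
    exact TwoSidedIdeal.mul_mem_left _ _ _ (TwoSidedIdeal.subset_span rfl)

end Central

/-! ### Monic right divisors -/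

section Monic

variable {R : Type*} [CommRing R] {σ : R →+* R} {m : ℕ}

/-- Since `z ^ m - 1` is central, a cofactor of a monic right divisor commutes with it. -/
theorem MonicOfDegree.mul_comm_of_mul_eq (hσ : ∀ r, σ^[m] r = r) {g h : SkewPoly σ} {d : ℕ}
    (hg : MonicOfDegree g d) (hgh : h * g = zPowSubOne σ m) : g * h = zPowSubOne σ m := by
  refine sub_eq_zero.1 (hg.eq_zero_of_mul fun k _ => ?_)
  rw [sub_mul, mul_assoc, hgh, zPowSubOne_comm hσ, sub_self, coef_zero]

/-- The leading coefficient of the cofactor is that of `z ^ m - 1`. -/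
theorem MonicOfDegree.cofactor [Nontrivial R] (hm : 0 < m) {g h : SkewPoly σ} {d : ℕ}
    (hg : MonicOfDegree g d) (hgh : h * g = zPowSubOne σ m) :
    d ≤ m ∧ MonicOfDegree h (m - d) := by
  have hz := monicOfDegree_zPowSubOne (σ := σ) hm
  have h0 : h ≠ 0 := by
    rintro rfl
    have := hz.1
    rw [← hgh, zero_mul, coef_zero] at this
    exact zero_ne_one this
  obtain ⟨N, hN, hN'⟩ := exists_leading h0
  have h1 := coef_mul_add hN' hg.2
  rw [hg.1, iterate_map_one, mul_one, hgh] at h1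
  have h2 : m = N + d := by
    rcases lt_trichotomy m (N + d) with hlt | heq | hgt
    · exact absurd (h1.symm.trans (hz.2 _ hlt)) hN
    · exact heq
    · have := coef_mul_of_lt hN' hg.2 hgt
      rw [hgh, hz.1] at this
      exact absurd this one_ne_zero
  refine ⟨by omega, ?_⟩
  rw [show m - d = N by omega]
  exact ⟨by rw [← h1, ← h2, hz.1], hN'⟩

/-- A left ideal has at most one monic generator. -/
theorem MonicOfDegree.eq_of_span_eq [Nontrivial R] {g g' : SkewPoly σ} {d d' : ℕ}
    (hg : MonicOfDegree g d) (hg' : MonicOfDegree g' d')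
    (h : (Ideal.span {g} : Ideal (SkewPoly σ)) = Ideal.span {g'}) : g = g' := by
  have key : ∀ {g g' : SkewPoly σ} {d d' : ℕ}, MonicOfDegree g d → MonicOfDegree g' d' →
      g' ∈ (Ideal.span {g} : Ideal (SkewPoly σ)) → d ≤ d' := by
    intro g g' d d' hg hg' hmem
    by_contra hlt
    obtain ⟨u, rfl⟩ := Submodule.mem_span_singleton.1 hmem
    have := hg.eq_zero_of_mul (f := u) (fun k hk => hg'.2 k (by omega))
    rw [this, zero_smul] at hg'
    exact zero_ne_one ((coef_zero (σ := σ) _).symm.trans hg'.1)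
  have h1 : g' ∈ (Ideal.span {g} : Ideal (SkewPoly σ)) := h ▸ Ideal.mem_span_singleton_self g'
  have h2 : g ∈ (Ideal.span {g'} : Ideal (SkewPoly σ)) := h ▸ Ideal.mem_span_singleton_self g
  obtain rfl : d = d' := le_antisymm (key hg hg' h1) (key hg' hg h2)
  obtain ⟨u, hu⟩ := Submodule.mem_span_singleton.1 (sub_mem (Ideal.mem_span_singleton_self g) h1)
  have := hg.eq_zero_of_mul (f := u) (fun k hk => by
    rw [← smul_eq_mul, hu, coef_sub]
    rcases eq_or_lt_of_le hk with rfl | hk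
    · rw [hg.1, hg'.1, sub_self]
    · rw [hg.2 k hk, hg'.2 k hk, sub_self])
  rw [this, zero_smul] at hu
  exact sub_eq_zero.1 hu.symm

/-- The remainders of a right division by a monic `g` of degree `d` represent the classes modulo
the left ideal generated by `g`, each exactly once. -/
theorem MonicOfDegree.card_quotient {g : SkewPoly σ} {d : ℕ} (hg : MonicOfDegree g d) :
    Nat.card (SkewPoly σ ⧸ (Ideal.span {g} : Ideal (SkewPoly σ))) = Nat.card R ^ d := by
  have hcoef : ∀ (v : Fin d → R) k, d ≤ k → coef (∑ j : Fin d, mono σ j (v j)) k = 0 := by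
    intro v k hk
    rw [coef_sum]
    exact Finset.sum_eq_zero fun j _ => by rw [coef_mono, if_neg (by omega)]
  have hcoef' : ∀ (v : Fin d → R) (i : Fin d), coef (∑ j : Fin d, mono σ j (v j)) i = v i := by
    intro v i
    rw [coef_sum, Finset.sum_eq_single i]
    · rw [coef_mono, if_pos rfl]
    · intro b _ hb
      rw [coef_mono, if_neg fun h => hb (Fin.ext h)]
    · simp
  have hbij : Function.Bijective (fun v : Fin d → R =>
      (Submodule.Quotient.mk (∑ j : Fin d, mono σ j (v j)) :
        SkewPoly σ ⧸ (Ideal.span {g} : Ideal (SkewPoly σ)))) := by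
    constructor
    · intro v w hvw
      obtain ⟨u, hu⟩ := Submodule.mem_span_singleton.1 ((Submodule.Quotient.eq _).1 hvw)
      have := hg.eq_zero_of_mul (f := u) (fun k hk => by
        rw [← smul_eq_mul, hu, coef_sub, hcoef v k hk, hcoef w k hk, sub_self])
      rw [this, zero_smul] at hu
      funext i
      rw [← hcoef' v i, ← hcoef' w i, sub_eq_zero.1 hu.symm]
    · intro x
      obtain ⟨f, rfl⟩ := Submodule.Quotient.mk_surjective _ x
      obtain ⟨u, hu⟩ := hg.exists_remainder f
      refine ⟨fun j => coef (f - u * g) j, ?_⟩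
      dsimp only
      rw [← eq_sum_mono hu, Submodule.Quotient.eq, sub_sub_cancel_left]
      exact neg_mem (Ideal.mul_mem_left _ _ (Ideal.mem_span_singleton_self g))
  rw [← Nat.card_eq_of_bijective _ hbij, Nat.card_fun, Nat.card_fin]

end Monic

/-! ### Left ideals over a field -/

section Field

variable {k : Type*} [Field k] {σ : k →+* k} {m : ℕ}

/-- A left ideal of `k[z; σ]` that contains `z ^ m - 1` has a monic generator: an element of least
degree, made monic. -/
theorem exists_monic_generator (J : Ideal (SkewPoly σ)) (hm : 0 < m)
    (hJ : zPowSubOne σ m ∈ J) : ∃ g d, MonicOfDegree g d ∧ J = Ideal.span {g} := by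
  classical
  have hex : ∃ d, ∃ g ∈ J, MonicOfDegree g d := ⟨m, _, hJ, monicOfDegree_zPowSubOne hm⟩
  obtain ⟨g, hgJ, hg⟩ := Nat.find_spec hex
  refine ⟨g, _, hg, le_antisymm (fun f hf => ?_) ((Ideal.span_singleton_le_iff_mem J).2 hgJ)⟩
  obtain ⟨u, hu⟩ := hg.exists_remainder f
  have hr : f - u * g ∈ J := sub_mem hf (Ideal.mul_mem_left _ _ hgJ)
  by_cases h0 : f - u * g = 0
  · rw [sub_eq_zero.1 h0]
    exact Ideal.mul_mem_left _ _ (Ideal.mem_span_singleton_self g)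
  · exfalso
    obtain ⟨N, hN, hN'⟩ := exists_leading h0
    have hlt : N < Nat.find hex := by
      by_contra hle
      exact hN (hu N (by omega))
    refine Nat.find_min hex hlt
      ⟨mono σ 0 (coef (f - u * g) N)⁻¹ * (f - u * g), Ideal.mul_mem_left _ _ hr, ?_⟩
    have hc : ∀ k, 0 < k → coef (mono σ 0 (coef (f - u * g) N)⁻¹) k = 0 := fun k hk => by
      rw [coef_mono, if_neg hk.ne]
    constructor
    · have := coef_mul_add hc hN'
      rw [zero_add] at this
      rw [this, coef_mono, if_pos rfl, Function.iterate_zero, id, inv_mul_cancel₀ hN]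
    · intro j hj
      exact coef_mul_of_lt hc hN' (by omega)

end Field

/-! ### Products of fields -/

/-- A decomposition of a commutative ring `R` with an endomorphism `σ` as a finite product of
fields: the projections onto the factors, the endomorphisms that `σ` induces on them and the
idempotents. -/
structure FieldDecomposition {R : Type*} [CommRing R] (σ : R →+* R) {ι : Type*} [Fintype ι]
    [DecidableEq ι] (k : ι → Type*) [∀ i, Field (k i)] where
  /-- The projection onto a factor. -/
  proj : ∀ i, R →+* k i
  /-- The endomorphism of a factor that is induced by `σ`. -/
  endo : ∀ i, k i →+* k i
  comm : ∀ i r, endo i (proj i r) = proj i (σ r)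
  surjective : ∀ i, Function.Surjective (proj i)
  eq_zero : ∀ r, (∀ i, proj i r = 0) → r = 0
  /-- The idempotent that belongs to a factor. -/
  idem : ι → R
  proj_idem : ∀ i j, proj j (idem i) = if i = j then 1 else 0

namespace FieldDecomposition

variable {R : Type*} [CommRing R] {σ : R →+* R} {ι : Type*} [Fintype ι] [DecidableEq ι]
  {k : ι → Type*} [∀ i, Field (k i)] (D : FieldDecomposition σ k) {m : ℕ}

/-- The projection of `R[z; σ]` onto the skew polynomial ring over a factor. -/
def map (i : ι) : SkewPoly σ →+* SkewPoly (D.endo i) := skewMap (D.proj i) (D.comm i)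

theorem coef_map (i : ι) (f : SkewPoly σ) (j : ℕ) : coef (D.map i f) j = D.proj i (coef f j) :=
  coef_skewMap _ _ _ _

theorem map_mono (i : ι) (j : ℕ) (r : R) : D.map i (mono σ j r) = mono _ j (D.proj i r) :=
  skewMap_mono _ _ _ _

theorem map_zPowSubOne (i : ι) : D.map i (zPowSubOne σ m) = zPowSubOne _ m :=
  skewMap_zPowSubOne _ _ _

theorem eq_of_map {f g : SkewPoly σ} (h : ∀ i, D.map i f = D.map i g) : f = g := by
  refine skewPoly_ext fun j => sub_eq_zero.1 (D.eq_zero _ fun i => ?_)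
  rw [map_sub, ← coef_map, ← coef_map, h, sub_self]

theorem map_sum_idem (f : ι → SkewPoly σ) (j : ι) :
    D.map j (∑ i, mono σ 0 (D.idem i) * f i) = D.map j (f j) := by
  rw [map_sum, Finset.sum_eq_single j]
  · rw [map_mul, map_mono, D.proj_idem, if_pos rfl, mono_zero_one, one_mul]
  · intro i _ hij
    rw [map_mul, map_mono, D.proj_idem, if_neg hij, mono_zero, zero_mul]
  · simp

/-- Skew polynomials over the factors can be glued without raising the degree. -/
theorem exists_map_eq {N : ℕ} (f : ∀ i, SkewPoly (D.endo i))
    (hf : ∀ i j, N ≤ j → coef (f i) j = 0) :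
    ∃ F : SkewPoly σ, (∀ i, D.map i F = f i) ∧ ∀ j, N ≤ j → coef F j = 0 := by
  choose f' hf' _ using fun i => skewMap_surjective (D.proj i) (D.comm i) (D.surjective i) (f i)
    (hf i)
  have key : ∀ i, D.map i (∑ i, mono σ 0 (D.idem i) * f' i) = f i := fun i => by
    rw [map_sum_idem]
    exact hf' i
  exact ⟨_, key, fun j hj => D.eq_zero _ fun i => by rw [← coef_map, key, hf i j hj]⟩

theorem exists_map_eq' (f : ∀ i, SkewPoly (D.endo i)) : ∃ F : SkewPoly σ, ∀ i, D.map i F = f i := by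
  choose N hN using fun i => exists_coef_eq_zero (f i)
  obtain ⟨F, hF, _⟩ := D.exists_map_eq (N := Finset.univ.sup N) f
    fun i j hj => hN i j ((Finset.le_sup (Finset.mem_univ i)).trans hj)
  exact ⟨F, hF⟩

theorem map_surjective (i : ι) : Function.Surjective (D.map i) := fun f => by
  obtain ⟨F, hF⟩ := D.exists_map_eq' (Function.update 0 i f)
  exact ⟨F, by rw [hF, Function.update_self]⟩

/-- A left ideal of `R[z; σ]` is the product of its projections. -/
theorem mem_ideal_iff (I : Ideal (SkewPoly σ)) (f : SkewPoly σ) :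
    f ∈ I ↔ ∀ i, ∃ f' ∈ I, D.map i f' = D.map i f := by
  refine ⟨fun hf i => ⟨f, hf, rfl⟩, fun h => ?_⟩
  choose f' hf' hff' using h
  have : f = ∑ i, mono σ 0 (D.idem i) * f' i :=
    D.eq_of_map fun i => by rw [map_sum_idem, hff']
  rw [this]
  exact sum_mem fun i _ => Ideal.mul_mem_left _ _ (hf' i)

theorem mem_span_singleton_iff (g f : SkewPoly σ) :
    f ∈ (Ideal.span {g} : Ideal (SkewPoly σ)) ↔
      ∀ i, D.map i f ∈ (Ideal.span {D.map i g} : Ideal (SkewPoly (D.endo i))) := by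
  constructor
  · intro hf i
    obtain ⟨u, rfl⟩ := Submodule.mem_span_singleton.1 hf
    rw [smul_eq_mul, map_mul]
    exact Ideal.mul_mem_left _ _ (Ideal.mem_span_singleton_self _)
  · intro h
    refine (D.mem_ideal_iff _ _).2 fun i => ?_
    obtain ⟨u, hu⟩ := Submodule.mem_span_singleton.1 (h i)
    obtain ⟨u', rfl⟩ := D.map_surjective i u
    exact ⟨u' * g, Ideal.mul_mem_left _ _ (Ideal.mem_span_singleton_self _), by
      rw [map_mul, ← hu, smul_eq_mul]⟩

/-- Every left ideal that contains `z ^ m - 1` is generated by a factor of `z ^ m - 1` all of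
whose projections are monic. -/
theorem exists_generator (hm : 0 < m) (hσ : ∀ r, σ^[m] r = r) (I : Ideal (SkewPoly σ))
    (hI : zPowSubOne σ m ∈ I) :
    ∃ g h : SkewPoly σ, I = Ideal.span {g} ∧ g * h = zPowSubOne σ m ∧ h * g = zPowSubOne σ m ∧
      ∀ i, (∃ d, MonicOfDegree (D.map i g) d) ∧ ∃ d, MonicOfDegree (D.map i h) d := by
  have hJ : ∀ i, zPowSubOne (D.endo i) m ∈ I.map (D.map i) := fun i => by
    rw [← D.map_zPowSubOne i]
    exact Ideal.mem_map_of_mem _ hI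
  choose g d hg hgJ using fun i => exists_monic_generator _ hm (hJ i)
  have hh : ∀ i, ∃ h, h * g i = zPowSubOne (D.endo i) m := fun i => by
    have := hJ i
    rw [hgJ i] at this
    exact Submodule.mem_span_singleton.1 this
  choose h hh using hh
  have hσi : ∀ i r, (D.endo i)^[m] r = r := by
    intro i r
    obtain ⟨r, rfl⟩ := D.surjective i r
    have : ∀ n, (D.endo i)^[n] (D.proj i r) = D.proj i (σ^[n] r) := fun n => by
      induction n with
      | zero => rfl
      | succ n ih => rw [Function.iterate_succ_apply', Function.iterate_succ_apply', ih, D.comm]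
    rw [this, hσ]
  obtain ⟨G, hG⟩ := D.exists_map_eq' g
  obtain ⟨H, hH⟩ := D.exists_map_eq' h
  refine ⟨G, H, ?_, ?_, ?_, fun i => ⟨⟨d i, ?_⟩, ⟨m - d i, ?_⟩⟩⟩
  · ext f
    rw [D.mem_span_singleton_iff]
    simp only [hG, ← hgJ]
    refine ⟨fun hf i => Ideal.mem_map_of_mem _ hf, fun hf => (D.mem_ideal_iff _ _).2 fun i => ?_⟩
    exact (Ideal.mem_map_iff_of_surjective _ (D.map_surjective i)).1 (hf i)
  · refine D.eq_of_map fun i => ?_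
    rw [map_mul, hG, hH, D.map_zPowSubOne]
    exact (hg i).mul_comm_of_mul_eq (hσi i) (hh i)
  · refine D.eq_of_map fun i => ?_
    rw [map_mul, hG, hH, D.map_zPowSubOne, hh]
  · rw [hG]
    exact hg i
  · rw [hH]
    exact ((hg i).cofactor hm (hh i)).2

theorem generator_unique {g g' : SkewPoly σ}
    (hg : ∀ i, ∃ d, MonicOfDegree (D.map i g) d) (hg' : ∀ i, ∃ d, MonicOfDegree (D.map i g') d)
    (h : (Ideal.span {g} : Ideal (SkewPoly σ)) = Ideal.span {g'}) : g = g' := by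
  refine D.eq_of_map fun i => ?_
  obtain ⟨d, hd⟩ := hg i
  obtain ⟨d', hd'⟩ := hg' i
  refine hd.eq_of_span_eq hd' ?_
  have key : ∀ g : SkewPoly σ, (Ideal.span {D.map i g} : Ideal (SkewPoly (D.endo i))) =
      (Ideal.span {g} : Ideal (SkewPoly σ)).map (D.map i) := fun g => by
    rw [Ideal.map_span, Set.image_singleton]
  rw [key, key, h]

/-- The additive map that sends `f` to the classes of its projections modulo the left ideals
generated by the projections of `g`. -/
def residues (g : SkewPoly σ) : SkewPoly σ →+
    ∀ i, SkewPoly (D.endo i) ⧸ (Ideal.span {D.map i g} : Ideal (SkewPoly (D.endo i))) :=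
  AddMonoidHom.mk' (fun f i => Submodule.Quotient.mk (D.map i f)) fun f f' => by
    funext i
    simp

theorem residues_eq_zero_iff (g f : SkewPoly σ) :
    D.residues g f = 0 ↔ f ∈ (Ideal.span {g} : Ideal (SkewPoly σ)) := by
  rw [D.mem_span_singleton_iff, funext_iff]
  exact forall_congr' fun i => Submodule.Quotient.mk_eq_zero _

/-- Every family of residues is attained by a skew polynomial whose degree is less than the bound
`N` on the degrees of the moduli. -/
theorem exists_residues_eq {g : SkewPoly σ} {N : ℕ} {d : ι → ℕ}
    (hg : ∀ i, MonicOfDegree (D.map i g) (d i)) (hd : ∀ i, d i ≤ N)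
    (x : ∀ i, SkewPoly (D.endo i) ⧸ (Ideal.span {D.map i g} : Ideal (SkewPoly (D.endo i)))) :
    ∃ f, D.residues g f = x ∧ ∀ j, N ≤ j → coef f j = 0 := by
  choose f hf using fun i => Submodule.Quotient.mk_surjective _ (x i)
  choose u hu using fun i => (hg i).exists_remainder (f i)
  obtain ⟨F, hF, hF'⟩ := D.exists_map_eq (N := N) (fun i => f i - u i * D.map i g)
    fun i j hj => hu i j ((hd i).trans hj)
  refine ⟨F, funext fun i => ?_, hF'⟩
  change Submodule.Quotient.mk (D.map i F) = _
  rw [hF, ← hf, Submodule.Quotient.eq, sub_sub_cancel_left]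
  exact neg_mem (Ideal.mul_mem_left _ _ (Ideal.mem_span_singleton_self _))

end FieldDecomposition

/-! ### Skew polynomials as linear operators -/

section Operator

variable {K E : Type*} [Field K] [Field E] [Algebra K E] {τ : E →+* E}

/-- An endomorphism of the field `E` that fixes `K`, as a linear map over `K`. -/
def endoLinear (hτ : ∀ a : K, τ (algebraMap K E a) = algebraMap K E a) : Module.End K E where
  toFun := τ
  map_add' := map_add τ
  map_smul' a x := by rw [Algebra.smul_def, map_mul, hτ, ← Algebra.smul_def, RingHom.id_apply]

/-- The action of `E[z; τ]` on `E` in which constants act by multiplication and `z` acts as `τ`. -/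
def operator (hτ : ∀ a : K, τ (algebraMap K E a) = algebraMap K E a) :
    SkewPoly τ →+* Module.End K E :=
  skewLift (Algebra.lmul K E).toRingHom (endoLinear hτ) fun r => by
    ext x
    simp [endoLinear]

variable (hτ : ∀ a : K, τ (algebraMap K E a) = algebraMap K E a)

theorem operator_mono (k : ℕ) (r β : E) : operator hτ (mono τ k r) β = r * τ^[k] β := by
  rw [operator, skewLift_mono]
  have : ∀ k : ℕ, (endoLinear hτ ^ k) β = τ^[k] β := fun k => by
    rw [Module.End.pow_apply]; rfl
  simp [this]

/-- Modulo the left ideal generated by `z - τ(β) β⁻¹` every `f` is congruent to a constant `r`, and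
`f` maps `β` to `r β`. -/
theorem mem_rootIdeal_iff {β : E} (hβ : β ≠ 0) (f : SkewPoly τ) :
    f ∈ rootIdeal τ β ↔ operator hτ f β = 0 := by
  have hop : operator hτ (mono τ 1 1 - mono τ 0 (τ β * β⁻¹)) β = 0 := by
    rw [map_sub, LinearMap.sub_apply, operator_mono, operator_mono]
    simp [hβ]
  have hmon : MonicOfDegree (mono τ 1 1 - mono τ 0 (τ β * β⁻¹)) 1 := by
    refine ⟨by simp [coef_sub, coef_mono], fun k hk => ?_⟩
    rw [coef_sub, coef_mono, coef_mono, if_neg hk.ne, if_neg (by omega), sub_zero]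
  obtain ⟨u, hu⟩ := hmon.exists_remainder f
  have hmem : u * (mono τ 1 1 - mono τ 0 (τ β * β⁻¹)) ∈ rootIdeal τ β :=
    Ideal.mul_mem_left _ _ (Ideal.mem_span_singleton_self _)
  constructor
  · intro hf
    obtain ⟨v, rfl⟩ := Submodule.mem_span_singleton.1 hf
    rw [smul_eq_mul, map_mul, Module.End.mul_apply, hop, map_zero]
  · intro hf
    obtain ⟨r, hr⟩ : ∃ r, f - u * (mono τ 1 1 - mono τ 0 (τ β * β⁻¹)) = mono τ 0 r :=
      ⟨coef (f - u * (mono τ 1 1 - mono τ 0 (τ β * β⁻¹))) 0, (eq_sum_mono hu).trans (by simp)⟩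
    have h1 : operator hτ (mono τ 0 r) β = 0 := by
      rw [← hr, map_sub, map_mul, LinearMap.sub_apply, Module.End.mul_apply, hop, map_zero, hf,
        sub_zero]
    rw [operator_mono, Function.iterate_zero, id, mul_eq_zero, or_iff_left hβ] at h1
    rw [h1, mono_zero, sub_eq_zero] at hr
    rw [hr]
    exact hmem

theorem iterate_frobenius {E : Type*} [Field E] {τ : E →+* E} {q : ℕ} (hτ : ∀ x, τ x = x ^ q)
    (k : ℕ) (x : E) : τ^[k] x = x ^ q ^ k := by
  induction k with
  | zero => simp
  | succ k ih => rw [Function.iterate_succ_apply', ih, hτ, ← pow_mul, pow_succ]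

/-- A monic skew polynomial of degree `d` acts as a linearized polynomial of degree `q ^ d`, which
has at most `q ^ d` roots. -/
theorem finrank_ker_operator_le [Finite E] {q : ℕ} (hq : 1 < q) (hK : Nat.card K = q)
    (hτq : ∀ x, τ x = x ^ q) {f : SkewPoly τ} {d : ℕ} (hf : MonicOfDegree f d) :
    Module.finrank K (LinearMap.ker (operator hτ f)) ≤ d := by
  classical
  have : Fintype E := Fintype.ofFinite E
  let P : E[X] := ∑ j : Fin (d + 1), C (coef f j) * X ^ (q ^ (j : ℕ))
  have hcoeff : P.coeff (q ^ d) = 1 := by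
    simp only [P, finsetSum_coeff, coeff_C_mul_X_pow]
    rw [Finset.sum_eq_single (Fin.last d)]
    · simp [hf.1]
    · intro b _ hb
      exact if_neg fun h => hb (Fin.ext (Nat.pow_right_injective hq h).symm)
    · simp
  have hP0 : P ≠ 0 := by
    intro h
    rw [h, coeff_zero] at hcoeff
    exact zero_ne_one hcoeff
  have hdeg : P.natDegree ≤ q ^ d :=
    natDegree_sum_le_of_forall_le _ _ fun j _ =>
      (natDegree_C_mul_X_pow_le _ _).trans (Nat.pow_le_pow_right (by omega) (by omega))
  have heval : ∀ β, operator hτ f β = P.eval β := by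
    intro β
    conv_lhs => rw [eq_sum_mono (f := f) (N := d + 1) fun k hk => hf.2 k hk]
    simp [P, eval_finsetSum, operator_mono, iterate_frobenius hτq, LinearMap.sum_apply]
  have hsub : (LinearMap.ker (operator hτ f) : Set E) ⊆ (P.roots.toFinset : Set E) := by
    intro β hβ
    have : operator hτ f β = 0 := hβ
    rw [heval] at this
    simpa [hP0] using this
  have hcard : Nat.card (LinearMap.ker (operator hτ f)) ≤ q ^ d := by
    calc Nat.card (LinearMap.ker (operator hτ f))
        = (LinearMap.ker (operator hτ f) : Set E).ncard := rfl
      _ ≤ (P.roots.toFinset : Set E).ncard := Set.ncard_le_ncard hsub (Finset.finite_toSet _)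
      _ = P.roots.toFinset.card := Set.ncard_coe_finset _
      _ ≤ P.natDegree := (Multiset.toFinset_card_le _).trans (card_roots' P)
      _ ≤ q ^ d := hdeg
  have : Finite K := Nat.finite_of_card_ne_zero (by omega)
  rw [Module.natCard_eq_pow_finrank (K := K), hK] at hcard
  exact (Nat.pow_le_pow_iff_right hq).1 hcard

theorem finrank_eq_of_card [Finite E] {q m : ℕ} (hq : 1 < q) (hK : Nat.card K = q)
    (hE : Nat.card E = q ^ m) : Module.finrank K E = m := by
  have : Finite K := Nat.finite_of_card_ne_zero (by omega)
  rw [Module.natCard_eq_pow_finrank (K := K), hK] at hE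
  exact Nat.pow_right_injective hq hE

/-- For a monic factor `g` of `z ^ m - 1`, the bound on the dimension of the kernel is attained:
the kernel of `g` contains the image of the cofactor of `g`. -/
theorem finrank_ker_operator [Finite E] {q m : ℕ} (hq : 1 < q) (hK : Nat.card K = q)
    (hE : Nat.card E = q ^ m) (hτq : ∀ x, τ x = x ^ q) {g h : SkewPoly τ} {d : ℕ} (hm : 0 < m)
    (hg : MonicOfDegree g d) (hgh : g * h = zPowSubOne τ m) (hhg : h * g = zPowSubOne τ m) :
    Module.finrank K (LinearMap.ker (operator hτ g)) = d := by
  obtain ⟨hd, hh⟩ := hg.cofactor hm hhg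
  have hz : operator hτ (zPowSubOne τ m) = 0 := by
    ext β
    have : Fintype E := Fintype.ofFinite E
    rw [zPowSubOne, ← mono_zero_one, map_sub, LinearMap.sub_apply, operator_mono, operator_mono,
      iterate_frobenius hτq, ← hE, Nat.card_eq_fintype_card, FiniteField.pow_card]
    simp
  have hle : LinearMap.range (operator hτ h) ≤ LinearMap.ker (operator hτ g) := by
    rintro _ ⟨x, rfl⟩
    rw [LinearMap.mem_ker, ← Module.End.mul_apply, ← map_mul, hgh, hz, LinearMap.zero_apply]
  have h1 := LinearMap.finrank_range_add_finrank_ker (operator hτ h)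
  rw [finrank_eq_of_card hq hK hE] at h1
  have h2 := Submodule.finrank_mono hle
  have h3 := finrank_ker_operator_le hτ hq hK hτq hh
  have h4 := finrank_ker_operator_le hτ hq hK hτq hg
  omega

end Operator

/-! ### Coefficients in `F[x] / (x ^ ℓ - 1)` -/

section Coefficients

variable {F : Type*} [Field F] {ℓ m : ℕ}

theorem extend_mk (σ : F →+* F) (p : F[X]) :
    extend σ ℓ (AdjoinRoot.mk _ p) = AdjoinRoot.mk _ (p.map σ) := by
  rw [extend, AdjoinRoot.map, AdjoinRoot.lift_mk, ← eval₂_map]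
  exact AdjoinRoot.aeval_eq (p.map σ)

theorem extend_iterate {σ : F →+* F} (hσ : ∀ x, σ^[m] x = x) (r : S F ℓ) :
    (extend σ ℓ)^[m] r = r := by
  have key : ∀ (n : ℕ) (p : F[X]),
      (extend σ ℓ)^[n] (AdjoinRoot.mk _ p) = AdjoinRoot.mk _ (p.map (σ ^ n)) := by
    intro n
    induction n with
    | zero => intro p; simp [RingHom.one_def]
    | succ n ih =>
      intro p
      rw [Function.iterate_succ_apply', ih, extend_mk, Polynomial.map_map, pow_succ']
      rfl
  obtain ⟨p, rfl⟩ := AdjoinRoot.mk_surjective r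
  rw [key]
  congr 1
  ext n
  rw [coeff_map, RingHom.coe_pow, hσ]

/-- The element `∑ i, v i x ^ i` of `F[x] / (x ^ ℓ - 1)`. -/
def blockPoly (v : Fin ℓ → F) : S F ℓ :=
  ∑ i : Fin ℓ, AdjoinRoot.mk (X ^ ℓ - 1) (C (v i) * X ^ (i : ℕ))

theorem blockPoly_eq_mk (v : Fin ℓ → F) :
    blockPoly v = AdjoinRoot.mk (X ^ ℓ - 1) (∑ i : Fin ℓ, C (v i) * X ^ (i : ℕ)) :=
  (map_sum _ _ _).symm

theorem blockPoly_add (v w : Fin ℓ → F) : blockPoly (v + w) = blockPoly v + blockPoly w := by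
  simp only [blockPoly, ← Finset.sum_add_distrib, ← map_add, ← add_mul, Pi.add_apply]

theorem blockPoly_smul (a : F) (v : Fin ℓ → F) :
    blockPoly (a • v) = AdjoinRoot.mk _ (C a) * blockPoly v := by
  simp only [blockPoly, Finset.mul_sum, ← map_mul, Pi.smul_apply, smul_eq_mul, ← mul_assoc]

theorem extend_blockPoly (σ : F →+* F) (v : Fin ℓ → F) :
    extend σ ℓ (blockPoly v) = blockPoly fun i => σ (v i) := by
  simp [blockPoly, map_sum, extend_mk, -map_mul]

theorem blockPoly_shift (v : Fin ℓ → F) :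
    blockPoly (fun i => v ((finRotate ℓ).symm i)) = AdjoinRoot.mk _ X * blockPoly v := by
  rw [blockPoly, blockPoly, Finset.mul_sum, ← Equiv.sum_comp (finRotate ℓ)]
  refine Finset.sum_congr rfl fun i _ => ?_
  rw [Equiv.symm_apply_apply, ← map_mul]
  cases ℓ with
  | zero => exact i.elim0
  | succ n =>
    rw [coe_finRotate]
    split_ifs with hi
    · rw [hi, Fin.val_last, AdjoinRoot.mk_eq_mk]
      exact ⟨-C (v (Fin.last n)), by ring⟩
    · congr 1
      ring

theorem X_pow_sub_one_degree (hℓ : 0 < ℓ) : (X ^ ℓ - 1 : F[X]).degree = ℓ := by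
  simpa using degree_X_pow_sub_C hℓ (1 : F)

theorem degree_blockSum_lt (v : Fin ℓ → F) :
    (∑ i : Fin ℓ, C (v i) * X ^ (i : ℕ) : F[X]).degree < ℓ := by
  refine (degree_sum_le _ _).trans_lt ((Finset.sup_lt_iff (WithBot.bot_lt_coe _)).2 fun i _ => ?_)
  exact (degree_C_mul_X_pow_le _ _).trans_lt (WithBot.coe_lt_coe.2 i.2)

theorem blockPoly_injective (hℓ : 0 < ℓ) :
    Function.Injective (blockPoly : (Fin ℓ → F) → S F ℓ) := by
  intro v w hvw
  rw [blockPoly_eq_mk, blockPoly_eq_mk, AdjoinRoot.mk_eq_mk] at hvw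
  have h0 := sub_eq_zero.1 (eq_zero_of_dvd_of_degree_lt hvw (by
    rw [X_pow_sub_one_degree hℓ]
    exact (degree_sub_le _ _).trans_lt (max_lt (degree_blockSum_lt v) (degree_blockSum_lt w))))
  have hcoeff : ∀ (v : Fin ℓ → F) (i : Fin ℓ),
      (∑ i : Fin ℓ, C (v i) * X ^ (i : ℕ) : F[X]).coeff i = v i := by
    intro v i
    simp only [finsetSum_coeff, coeff_C_mul_X_pow]
    rw [Finset.sum_eq_single i]
    · simp
    · intro b _ hb
      exact if_neg fun h => hb (Fin.ext h.symm)
    · simp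
  funext i
  rw [← hcoeff v i, h0, hcoeff]

theorem blockPoly_surjective (hℓ : 0 < ℓ) :
    Function.Surjective (blockPoly : (Fin ℓ → F) → S F ℓ) := by
  intro r
  obtain ⟨p, rfl⟩ := AdjoinRoot.mk_surjective r
  have hmonic : (X ^ ℓ - 1 : F[X]).Monic := monic_X_pow_sub_C 1 hℓ.ne'
  have hdeg : (p %ₘ (X ^ ℓ - 1)).natDegree < ℓ := by
    have h := degree_modByMonic_lt p hmonic
    rw [X_pow_sub_one_degree hℓ] at h
    by_cases h0 : p %ₘ (X ^ ℓ - 1) = 0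
    · rw [h0, natDegree_zero]; exact hℓ
    · exact (natDegree_lt_iff_degree_lt h0).2 h
  refine ⟨fun i => (p %ₘ (X ^ ℓ - 1)).coeff i, ?_⟩
  have hsum : ∑ i : Fin ℓ, C ((p %ₘ (X ^ ℓ - 1)).coeff i) * X ^ (i : ℕ) = p %ₘ (X ^ ℓ - 1) :=
    (Fin.sum_univ_eq_sum_range (fun i => C ((p %ₘ (X ^ ℓ - 1)).coeff i) * X ^ i) ℓ).trans
      (as_sum_range_C_mul_X_pow' _ hdeg).symm
  rw [blockPoly_eq_mk, hsum, AdjoinRoot.mk_eq_mk]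
  exact ⟨-(p /ₘ (X ^ ℓ - 1)), by linear_combination modByMonic_add_div p (X ^ ℓ - 1)⟩

end Coefficients

/-! ### Codes as left ideals -/

section CodePoly

variable {F : Type*} [Field F] {ℓ m : ℕ} (σ : F →+* F)

/-- The representative of degree less than `m` in `z` of the residue class of a word. -/
def codePoly : (Fin ℓ → Fin m → F) →+ SkewS σ ℓ :=
  AddMonoidHom.mk' (fun c => ∑ j : Fin m, mono (extend σ ℓ) j (blockPoly fun i => c i j))
    fun c c' => by
      rw [← Finset.sum_add_distrib]
      refine Finset.sum_congr rfl fun j _ => ?_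
      rw [← mono_add, ← blockPoly_add]
      rfl

theorem codePoly_apply (c : Fin ℓ → Fin m → F) :
    codePoly σ c = ∑ j : Fin m, mono (extend σ ℓ) j (blockPoly fun i => c i j) := rfl

theorem nu_eq (c : Fin ℓ → Fin m → F) : nu σ c = toR σ ℓ m (codePoly σ c) := rfl

theorem coef_codePoly (c : Fin ℓ → Fin m → F) (j : Fin m) :
    coef (codePoly σ c) j = blockPoly fun i => c i j := by
  rw [codePoly_apply, coef_sum, Finset.sum_eq_single j]
  · rw [coef_mono, if_pos rfl]
  · intro b _ hb
    rw [coef_mono, if_neg fun h => hb (Fin.ext h)]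
  · simp

theorem coef_codePoly_of_le (c : Fin ℓ → Fin m → F) {k : ℕ} (hk : m ≤ k) :
    coef (codePoly σ c) k = 0 := by
  rw [codePoly_apply, coef_sum]
  exact Finset.sum_eq_zero fun j _ => by rw [coef_mono, if_neg (by omega)]

theorem codePoly_injective (hℓ : 0 < ℓ) :
    Function.Injective (codePoly σ : (Fin ℓ → Fin m → F) →+ SkewS σ ℓ) := by
  intro c c' h
  funext i j
  have := coef_codePoly σ c j
  rw [h, coef_codePoly] at this
  exact (congrFun (blockPoly_injective hℓ this) i).symm

theorem exists_codePoly_eq (hℓ : 0 < ℓ) {f : SkewS σ ℓ} (hf : ∀ k, m ≤ k → coef f k = 0) :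
    ∃ c : Fin ℓ → Fin m → F, codePoly σ c = f := by
  choose v hv using fun j : Fin m => blockPoly_surjective hℓ (coef f j)
  refine ⟨fun i j => v j i, ?_⟩
  rw [codePoly_apply, eq_sum_mono hf]
  exact Finset.sum_congr rfl fun j _ => by rw [hv]

theorem codePoly_smul (a : F) (c : Fin ℓ → Fin m → F) :
    codePoly σ (a • c) = mono _ 0 (AdjoinRoot.mk _ (C a)) * codePoly σ c := by
  rw [codePoly_apply, codePoly_apply, Finset.mul_sum]
  refine Finset.sum_congr rfl fun j _ => ?_
  rw [mono_mul_mono, zero_add, Function.iterate_zero, id, ← blockPoly_smul]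
  rfl

theorem codePoly_interShift (c : Fin ℓ → Fin m → F) :
    codePoly σ (interShift c) = mono _ 0 (AdjoinRoot.mk _ X) * codePoly σ c := by
  rw [codePoly_apply, codePoly_apply, Finset.mul_sum]
  refine Finset.sum_congr rfl fun j _ => ?_
  rw [mono_mul_mono, zero_add, Function.iterate_zero, id, ← blockPoly_shift]
  rfl

/-- Up to a multiple of `z ^ m - 1`, the shift inside the blocks is multiplication by `z`. -/
theorem exists_mul_codePoly_eq (c : Fin ℓ → Fin m → F) :
    ∃ u, mono (extend σ ℓ) 1 1 * codePoly σ c =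
      codePoly σ (intraShift σ c) + u * zPowSubOne (extend σ ℓ) m := by
  have h1 : codePoly σ (intraShift σ c) =
      ∑ j : Fin m, mono _ (finRotate m j) (extend σ ℓ (blockPoly fun i => c i j)) := by
    rw [codePoly_apply, ← Equiv.sum_comp (finRotate m)]
    refine Finset.sum_congr rfl fun j _ => ?_
    rw [extend_blockPoly]
    simp only [intraShift, Equiv.symm_apply_apply]
  have h2 : ∀ j : Fin m, ∃ u, mono (extend σ ℓ) 1 1 * mono _ j (blockPoly fun i => c i j) =
      mono _ (finRotate m j) (extend σ ℓ (blockPoly fun i => c i j)) +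
        u * zPowSubOne (extend σ ℓ) m := by
    intro j
    cases m with
    | zero => exact j.elim0
    | succ n =>
      rw [coe_finRotate, mono_mul_mono, one_mul, Function.iterate_one]
      split_ifs with hj
      · refine ⟨mono _ 0 (extend σ ℓ (blockPoly fun i => c i j)), ?_⟩
        rw [zPowSubOne, mul_sub, mono_mul_mono, mul_one, Function.iterate_zero, id, mul_one,
          add_sub_cancel, hj, Fin.val_last, zero_add, add_comm 1 n]
      · exact ⟨0, by rw [zero_mul, add_zero, add_comm]⟩
  choose u hu using h2
  refine ⟨∑ j, u j, ?_⟩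
  rw [h1, codePoly_apply, Finset.mul_sum, Finset.sum_mul, ← Finset.sum_add_distrib]
  exact Finset.sum_congr rfl fun j _ => hu j

theorem toR_surjective : Function.Surjective (toR σ ℓ m) := RingCon.mk'_surjective _

variable {σ}

theorem toR_eq_toR_iff (hσ : ∀ x, σ^[m] x = x) (f g : SkewS σ ℓ) :
    toR σ ℓ m f = toR σ ℓ m g ↔ ∃ u, f - g = u * zPowSubOne (extend σ ℓ) m := by
  rw [← mem_span_zPowSubOne_iff (extend_iterate hσ), ← TwoSidedIdeal.rel_iff]
  exact RingCon.eq _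

theorem nu_injective (hσ : ∀ x, σ^[m] x = x) (hm : 0 < m) (hℓ : 0 < ℓ) :
    Function.Injective (nu σ : (Fin ℓ → Fin m → F) → RingR σ ℓ m) := by
  intro c c' h
  rw [nu_eq, nu_eq] at h
  obtain ⟨u, hu⟩ := (toR_eq_toR_iff hσ _ _).1 h
  have := (monicOfDegree_zPowSubOne hm).eq_zero_of_mul (f := u) fun k hk => by
    rw [← hu, coef_sub, coef_codePoly_of_le σ c hk, coef_codePoly_of_le σ c' hk, sub_zero]
  rw [this, zero_mul, sub_eq_zero] at hu
  exact codePoly_injective σ hℓ hu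

/-- The left ideal of `S[z; σ]` that consists of the representatives of the words of a
cyclic-skew-cyclic code. -/
def codeIdeal (hσ : ∀ x, σ^[m] x = x) {C : Submodule F (Fin ℓ → Fin m → F)} (hC : IsCSC σ C) :
    Ideal (SkewS σ ℓ) where
  carrier := {f | toR σ ℓ m f ∈ nu σ '' C}
  add_mem' := by
    rintro f g ⟨c, hc, hf⟩ ⟨d, hd, hg⟩
    exact ⟨c + d, add_mem hc hd, by rw [nu_eq, map_add, map_add, map_add, ← nu_eq, ← nu_eq, hf, hg]⟩
  zero_mem' := ⟨0, zero_mem _, by rw [nu_eq, map_zero]⟩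
  smul_mem' := by
    -- The multipliers that preserve the code form a subsemiring, which contains the generators
    -- of `S[z; σ]`: the constants from `F`, the variable `x` and the variable `z`.
    let T : Subsemiring (SkewS σ ℓ) :=
      { carrier := {r | ∀ c ∈ C, toR σ ℓ m r * nu σ c ∈ nu σ '' C}
        mul_mem' := by
          intro r s hr hs c hc
          obtain ⟨d, hd, hd'⟩ := hs c hc
          rw [map_mul, mul_assoc, ← hd']
          exact hr d hd
        one_mem' := fun c hc => ⟨c, hc, by rw [map_one, one_mul]⟩
        add_mem' := by
          intro r s hr hs c hc
          obtain ⟨d, hd, hd'⟩ := hr c hc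
          obtain ⟨d₁, hd₁, hd₁'⟩ := hs c hc
          exact ⟨d + d₁, add_mem hd hd₁, by
            rw [map_add, add_mul, ← hd', ← hd₁', nu_eq, map_add, map_add, ← nu_eq, ← nu_eq]⟩
        zero_mem' := fun c hc =>
          ⟨0, zero_mem _, by rw [map_zero, zero_mul, nu_eq, map_zero, map_zero]⟩ }
    have hconst : ∀ a : F, mono (extend σ ℓ) 0 (AdjoinRoot.mk _ (Polynomial.C a)) ∈ T :=
      fun a c hc => ⟨a • c, C.smul_mem a hc, by rw [nu_eq, codePoly_smul, map_mul, ← nu_eq]⟩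
    have hx : mono (extend σ ℓ) 0 (AdjoinRoot.mk _ X) ∈ T :=
      fun c hc => ⟨_, hC.1 c hc, by rw [nu_eq, codePoly_interShift, map_mul, ← nu_eq]⟩
    have hz : mono (extend σ ℓ) 1 1 ∈ T := fun c hc => by
      refine ⟨_, hC.2 c hc, ?_⟩
      obtain ⟨u, hu⟩ := exists_mul_codePoly_eq σ c
      rw [nu_eq, nu_eq, ← map_mul, eq_comm, toR_eq_toR_iff hσ]
      exact ⟨u, sub_eq_iff_eq_add'.2 hu⟩
    have hT : ∀ r, r ∈ T := by
      intro r
      induction r using skewPoly_induction with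
      | h_add f g hf hg => exact add_mem hf hg
      | h_mono k s =>
        have : mono (extend σ ℓ) k s = constHom (extend σ ℓ) s * mono _ 1 1 ^ k := by
          rw [mono_one_pow]
          simp [constHom, mono_mul_mono]
        rw [this]
        refine mul_mem ?_ (pow_mem hz k)
        obtain ⟨p, rfl⟩ := AdjoinRoot.mk_surjective s
        induction p using Polynomial.induction_on' with
        | add p q hp hq =>
          rw [map_add, map_add]
          refine add_mem (hp ?_) (hq ?_) <;>
          · rw [mono_one_pow]
            simp [constHom, mono_mul_mono]
        | monomial n a =>
          rw [← C_mul_X_pow_eq_monomial, map_mul, map_mul, map_pow, map_pow]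
          exact mul_mem (hconst a) (pow_mem hx n)
    rintro r f ⟨c, hc, hf⟩
    have := hT r c hc
    rwa [hf, ← map_mul] at this

theorem mem_codeIdeal (hσ : ∀ x, σ^[m] x = x) {C : Submodule F (Fin ℓ → Fin m → F)}
    (hC : IsCSC σ C) (f : SkewS σ ℓ) : f ∈ codeIdeal hσ hC ↔ toR σ ℓ m f ∈ nu σ '' C := Iff.rfl

theorem zPowSubOne_mem_codeIdeal (hσ : ∀ x, σ^[m] x = x) {C : Submodule F (Fin ℓ → Fin m → F)}
    (hC : IsCSC σ C) : zPowSubOne (extend σ ℓ) m ∈ codeIdeal hσ hC := by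
  refine ⟨0, zero_mem _, ?_⟩
  rw [nu_eq, map_zero, eq_comm, toR_eq_toR_iff hσ]
  exact ⟨1, by rw [sub_zero, one_mul]⟩

/-- The condition on the image in the quotient ring that defines a generator is a condition on the
left ideal in `S[z; σ]`, because `g` divides `z ^ m - 1`. -/
theorem image_eq_span_iff (hσ : ∀ x, σ^[m] x = x) {C : Submodule F (Fin ℓ → Fin m → F)}
    (hC : IsCSC σ C) {g h : SkewS σ ℓ} (hh : h * g = zPowSubOne (extend σ ℓ) m) :
    nu σ '' (C : Set (Fin ℓ → Fin m → F)) = (Ideal.span {toR σ ℓ m g} : Ideal (RingR σ ℓ m)) ↔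
      codeIdeal hσ hC = Ideal.span {g} := by
  have key : ∀ f, toR σ ℓ m f ∈ (Ideal.span {toR σ ℓ m g} : Ideal (RingR σ ℓ m)) ↔
      f ∈ (Ideal.span {g} : Ideal (SkewS σ ℓ)) := by
    intro f
    rw [Ideal.mem_span_singleton', Ideal.mem_span_singleton']
    constructor
    · rintro ⟨r, hr⟩
      obtain ⟨u, rfl⟩ := toR_surjective σ r
      rw [← map_mul, eq_comm, toR_eq_toR_iff hσ] at hr
      obtain ⟨v, hv⟩ := hr
      exact ⟨u + v * h, by rw [add_mul, mul_assoc, hh, ← hv, add_sub_cancel]⟩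
    · rintro ⟨u, rfl⟩
      exact ⟨toR σ ℓ m u, by rw [map_mul]⟩
  constructor
  · intro hgen
    ext f
    rw [mem_codeIdeal, hgen, ← key]
    rfl
  · intro hI
    ext x
    obtain ⟨f, rfl⟩ := toR_surjective σ x
    rw [← mem_codeIdeal hσ hC, hI, ← key]
    rfl

end CodePoly

/-! ### The irreducible factors of `x ^ ℓ - 1` -/

section Factors

variable {F : Type*} [Field F] {ℓ m : ℕ}

theorem algHomOfDvd_mk {P Q : F[X]} (h : P ∣ Q) (p : F[X]) :
    AdjoinRoot.algHomOfDvd F Q P h (AdjoinRoot.mk Q p) = AdjoinRoot.mk P p := by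
  rw [← AdjoinRoot.aeval_eq (f := Q), ← AdjoinRoot.aeval_eq (f := P), ← aeval_algHom_apply,
    AdjoinRoot.algHomOfDvd_root]

theorem adjoinRoot_map_mk {σ : F →+* F} {P : F[X]} (h : P ∣ P.map σ) (p : F[X]) :
    AdjoinRoot.map σ P P h (AdjoinRoot.mk P p) = AdjoinRoot.mk P (p.map σ) := by
  rw [AdjoinRoot.map, AdjoinRoot.lift_mk, ← eval₂_map]
  exact AdjoinRoot.aeval_eq (p.map σ)

/-- Being monic modulo `P` depends on `P` only up to associates. -/
theorem isMonicMod_of_associated {σ : F →+* F} {P Q : F[X]} (hPQ : Associated P Q)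
    (hP : P ∣ X ^ ℓ - 1) (hQ : Q ∣ X ^ ℓ - 1) {f : SkewS σ ℓ} (hf : IsMonicMod Q hQ f) :
    IsMonicMod P hP f := by
  have key : ∀ (r : S F ℓ) (c : F), AdjoinRoot.algHomOfDvd F _ Q hQ r = AdjoinRoot.mk Q (C c) →
      AdjoinRoot.algHomOfDvd F _ P hP r = AdjoinRoot.mk P (C c) := by
    intro r c hr
    obtain ⟨p, rfl⟩ := AdjoinRoot.mk_surjective r
    rw [algHomOfDvd_mk, AdjoinRoot.mk_eq_mk] at hr ⊢
    exact hPQ.dvd.trans hr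
  obtain ⟨d, hd, hd'⟩ := hf
  refine ⟨d, ?_, fun k hk => ?_⟩
  · simpa using key _ 1 (by simpa using hd)
  · simpa using key _ 0 (by simpa using hd' k hk)

theorem isCoprime_of_mul_dvd_X_pow_sub_one (hℓ : (ℓ : F) ≠ 0) {P Q : F[X]}
    (h : P * Q ∣ X ^ ℓ - 1) : IsCoprime P Q :=
  ((X_pow_sub_one_separable_iff.2 hℓ).of_dvd h).isCoprime

theorem exists_factorization (hℓ : 0 < ℓ) : ∃ (t : ℕ) (M : Fin t → F[X]),
    (∀ i, Irreducible (M i)) ∧ X ^ ℓ - 1 = ∏ i, M i := by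
  classical
  have hmonic : (X ^ ℓ - 1 : F[X]).Monic := monic_X_pow_sub_C 1 hℓ.ne'
  have hprod := UniqueFactorizationMonoid.prod_normalizedFactors_eq hmonic.ne_zero
  rw [hmonic.normalize_eq_self] at hprod
  set L := (UniqueFactorizationMonoid.normalizedFactors (X ^ ℓ - 1 : F[X])).toList with hL
  refine ⟨L.length, L.get, fun i => ?_, ?_⟩
  · exact UniqueFactorizationMonoid.irreducible_of_normalized_factor _
      (Multiset.mem_toList.1 (List.get_mem L i))
  · rw [← List.prod_ofFn, List.ofFn_get, hL, Multiset.prod_toList, hprod]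

/-- The Chinese remainder theorem for a coprime family, in the form of an idempotent. -/
theorem exists_idempotent {t : ℕ} (M : Fin t → F[X])
    (hcop : Pairwise (Function.onFun IsCoprime M)) (i : Fin t) :
    ∃ p : F[X], M i ∣ p - 1 ∧ ∀ j, j ≠ i → M j ∣ p := by
  obtain ⟨a, b, hab⟩ : IsCoprime (M i) (∏ j ∈ Finset.univ.erase i, M j) :=
    IsCoprime.prod_right fun j hj => hcop (Finset.ne_of_mem_erase hj).symm
  refine ⟨b * ∏ j ∈ Finset.univ.erase i, M j, ⟨-a, by linear_combination hab⟩, fun j hj => ?_⟩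
  exact (Finset.dvd_prod_of_mem M (Finset.mem_erase.2 ⟨hj, Finset.mem_univ j⟩)).mul_left b

/-- The decomposition of `F[x] / (x ^ ℓ - 1)` that belongs to a factorization of `x ^ ℓ - 1` into
pairwise coprime irreducible polynomials that are stable under `σ`. -/
def rootsDecomposition (σ : F →+* F) {t : ℕ} (M : Fin t → F[X]) [∀ i, Fact (Irreducible (M i))]
    (hM : X ^ ℓ - 1 = ∏ i, M i) (hcop : Pairwise (Function.onFun IsCoprime M))
    (hσ : ∀ i, M i ∣ (M i).map σ) :
    FieldDecomposition (extend σ ℓ) (fun i => AdjoinRoot (M i)) where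
  proj i := (AdjoinRoot.algHomOfDvd F (X ^ ℓ - 1) (M i)
    (hM ▸ Finset.dvd_prod_of_mem M (Finset.mem_univ i))).toRingHom
  endo i := AdjoinRoot.map σ (M i) (M i) (hσ i)
  comm i r := by
    obtain ⟨p, rfl⟩ := AdjoinRoot.mk_surjective r
    rw [extend_mk]
    simp only [AlgHom.toRingHom_eq_coe, RingHom.coe_coe, algHomOfDvd_mk]
    exact adjoinRoot_map_mk (hσ i) p
  surjective i x := by
    obtain ⟨p, rfl⟩ := AdjoinRoot.mk_surjective x
    exact ⟨AdjoinRoot.mk _ p, algHomOfDvd_mk _ p⟩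
  eq_zero r h := by
    obtain ⟨p, rfl⟩ := AdjoinRoot.mk_surjective r
    simp only [AlgHom.toRingHom_eq_coe, RingHom.coe_coe, algHomOfDvd_mk, AdjoinRoot.mk_eq_zero]
      at h
    rw [AdjoinRoot.mk_eq_zero, hM]
    exact Fintype.prod_dvd_of_coprime hcop h
  idem i := AdjoinRoot.mk _ (exists_idempotent M hcop i).choose
  proj_idem i j := by
    have hspec := (exists_idempotent M hcop i).choose_spec
    simp only [AlgHom.toRingHom_eq_coe, RingHom.coe_coe, algHomOfDvd_mk]
    split_ifs with hij
    · subst hij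
      rw [← map_one (AdjoinRoot.mk (M i)), AdjoinRoot.mk_eq_mk]
      exact hspec.1
    · rw [AdjoinRoot.mk_eq_zero]
      exact hspec.2 j (Ne.symm hij)

variable {σ : F →+* F} {t : ℕ} {M : Fin t → F[X]} [∀ i, Fact (Irreducible (M i))]

theorem isMonicMod_iff (hM : X ^ ℓ - 1 = ∏ i, M i)
    (hcop : Pairwise (Function.onFun IsCoprime M)) (hσM : ∀ i, M i ∣ (M i).map σ)
    (i : Fin t) (hi : M i ∣ X ^ ℓ - 1) (f : SkewS σ ℓ) :
    IsMonicMod (M i) hi f ↔ ∃ d, MonicOfDegree ((rootsDecomposition σ M hM hcop hσM).map i f) d := by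
  simp only [MonicOfDegree, FieldDecomposition.coef_map]
  rfl

theorem existsUnique_isMinimalGenerator (hM : X ^ ℓ - 1 = ∏ i, M i)
    (hcop : Pairwise (Function.onFun IsCoprime M)) (hσM : ∀ i, M i ∣ (M i).map σ)
    (hm : 0 < m) (hσ : ∀ x, σ^[m] x = x)
    {C : Submodule F (Fin ℓ → Fin m → F)} (hC : IsCSC σ C) : ∃! g, IsMinimalGenerator σ C g := by
  have hdvd : ∀ i, M i ∣ X ^ ℓ - 1 := fun i => hM ▸ Finset.dvd_prod_of_mem M (Finset.mem_univ i)
  have hirr : ∀ i, Irreducible (M i) := fun i => Fact.out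
  obtain ⟨g, h, hI, hgh, hhg, hmon⟩ := (rootsDecomposition σ M hM hcop hσM).exists_generator hm
    (extend_iterate hσ) (codeIdeal hσ hC) (zPowSubOne_mem_codeIdeal hσ hC)
  have hall : ∀ f : SkewS σ ℓ,
      (∀ i, ∃ d, MonicOfDegree ((rootsDecomposition σ M hM hcop hσM).map i f) d) →
      ∀ (P : F[X]) (hP : P ∣ X ^ ℓ - 1), Irreducible P → IsMonicMod P hP f := by
    intro f hf P hP hPirr
    obtain ⟨i, _, hi⟩ := (hPirr.prime.dvd_finsetProd_iff M).1 (hM ▸ hP)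
    exact isMonicMod_of_associated (hPirr.associated_of_dvd (hirr i) hi) hP (hdvd i)
      ((isMonicMod_iff hM hcop hσM i (hdvd i) f).2 (hf i))
  refine ⟨g, ⟨h, hall g fun i => (hmon i).1, hall h fun i => (hmon i).2,
    (image_eq_span_iff hσ hC hhg).2 hI, hgh, hhg⟩, ?_⟩
  rintro g' ⟨h', hg'⟩
  refine (rootsDecomposition σ M hM hcop hσM).generator_unique
    (fun i => (isMonicMod_iff hM hcop hσM i (hdvd i) g').1
      (hg'.monic_left (M i) (hdvd i) (hirr i))) (fun i => (hmon i).1) ?_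
  rw [← hI]
  exact ((image_eq_span_iff hσ hC hg'.mul_right).1 hg'.generates).symm

/-- The dimension of a code in terms of the degrees of the projections of its minimal generator:
taking residues identifies the quotient of the ambient space by the code with a product of spaces of
remainders. -/
theorem finrank_add_sum_eq [Finite F] (hM : X ^ ℓ - 1 = ∏ i, M i)
    (hcop : Pairwise (Function.onFun IsCoprime M)) (hσM : ∀ i, M i ∣ (M i).map σ)
    (hm : 0 < m) (hℓ : 0 < ℓ) (hσ : ∀ x, σ^[m] x = x)
    {C : Submodule F (Fin ℓ → Fin m → F)} (hC : IsCSC σ C) {g h : SkewS σ ℓ}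
    (hg : IsMinimalPair σ C g h) {d : Fin t → ℕ}
    (hd : ∀ i, MonicOfDegree ((rootsDecomposition σ M hM hcop hσM).map i g) (d i))
    (hdm : ∀ i, d i ≤ m) :
    Module.finrank F C + ∑ i, (M i).natDegree * d i = ℓ * m := by
  set D := rootsDecomposition σ M hM hcop hσM
  have hirr : ∀ i, Irreducible (M i) := fun i => Fact.out
  -- Surjectivity needs only representatives of degree less than `m`, because every `d i` is at
  -- most `m`; the words have exactly these representatives.
  let Ψ := (D.residues g).comp (codePoly σ : (Fin ℓ → Fin m → F) →+ SkewS σ ℓ)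
  have hsurj : Function.Surjective Ψ := by
    intro x
    obtain ⟨f, hf, hf'⟩ := D.exists_residues_eq hd hdm x
    obtain ⟨c, rfl⟩ := exists_codePoly_eq σ hℓ hf'
    exact ⟨c, hf⟩
  have hker : Ψ.ker = C.toAddSubgroup := by
    ext c
    rw [AddMonoidHom.mem_ker]
    change D.residues g (codePoly σ c) = 0 ↔ c ∈ C
    rw [D.residues_eq_zero_iff, ← (image_eq_span_iff hσ hC hg.mul_right).1 hg.generates,
      mem_codeIdeal, ← nu_eq]
    exact (nu_injective hσ hm hℓ).mem_set_image
  have h1 := Ψ.ker.card_mul_index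
  rw [AddSubgroup.index_ker, AddMonoidHom.range_eq_top.2 hsurj, hker] at h1
  have h2 : Nat.card (⊤ : AddSubgroup (∀ i, SkewPoly (D.endo i) ⧸
      (Ideal.span {D.map i g} : Ideal (SkewPoly (D.endo i))))) =
      Nat.card F ^ ∑ i, (M i).natDegree * d i := by
    rw [AddSubgroup.card_top, Nat.card_pi, ← Finset.prod_pow_eq_pow_sum]
    refine Finset.prod_congr rfl fun i _ => ?_
    rw [(hd i).card_quotient, pow_mul]
    congr 1
    have : Module.Finite F (AdjoinRoot (M i)) := (AdjoinRoot.powerBasis (hirr i).ne_zero).finite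
    rw [Module.natCard_eq_pow_finrank (K := F), (AdjoinRoot.powerBasis (hirr i).ne_zero).finrank,
      AdjoinRoot.powerBasis_dim]
  have h3 : Nat.card C.toAddSubgroup = Nat.card F ^ Module.finrank F C :=
    Module.natCard_eq_pow_finrank (K := F) (V := C)
  have h4 : Nat.card (Fin ℓ → Fin m → F) = Nat.card F ^ (ℓ * m) := by
    rw [Nat.card_fun, Nat.card_fun, Nat.card_fin, Nat.card_fin, ← pow_mul, mul_comm]
  rw [h2, h3, h4, ← pow_add] at h1
  exact Nat.pow_right_injective (Finite.one_lt_card (α := F)) h1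

end Factors

/-! ### Evaluation at the roots -/

section Evaluation

variable {F K E : Type*} [Field F] [Field K] [Field E] [Algebra F E] [Algebra K E] {ℓ m : ℕ}
  {σ : F →+* F} {τ : E →+* E}

/-- An irreducible factor of `x ^ ℓ - 1` over `F` has a root in `E` that comes from `K`, as
`x ^ ℓ - 1` splits over `K`. -/
theorem exists_root_of_dvd (hℓ : 0 < ℓ) (hroots : (X ^ ℓ - 1 : K[X]).Splits) {P : F[X]}
    (hP : P ∣ X ^ ℓ - 1) (hirr : Irreducible P) : ∃ a : K, aeval (algebraMap K E a) P = 0 := by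
  have hK : (X ^ ℓ - 1 : K[X]) ≠ 0 := (monic_X_pow_sub_C 1 hℓ.ne').ne_zero
  have hE : (X ^ ℓ - 1 : E[X]) ≠ 0 := (monic_X_pow_sub_C 1 hℓ.ne').ne_zero
  have hs : (X ^ ℓ - 1 : E[X]).Splits := by simpa using hroots.map (algebraMap K E)
  have hdvd : P.map (algebraMap F E) ∣ X ^ ℓ - 1 := by
    simpa using Polynomial.map_dvd (algebraMap F E) hP
  obtain ⟨b, hb⟩ := (hs.of_dvd hE hdvd).exists_eval_eq_zero (by
    rw [degree_map]
    exact (degree_pos_of_irreducible hirr).ne')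
  obtain ⟨a, rfl⟩ := hroots.mem_range_of_isRoot hK (i := algebraMap K E) (x := b) (by
    simpa using (show IsRoot (P.map (algebraMap F E)) b from hb).dvd hdvd)
  exact ⟨a, by rwa [aeval_def, ← eval_map]⟩

/-- An irreducible polynomial with a root that is fixed by the Frobenius endomorphism is stable
under that endomorphism. -/
theorem dvd_map_of_root (hστ : ∀ x, τ (algebraMap F E x) = algebraMap F E (σ x)) {P : F[X]}
    (hirr : Irreducible P) {b : E} (hb : τ b = b) (hP : aeval b P = 0) : P ∣ P.map σ := by
  have h0 : aeval b (P.map σ) = 0 := by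
    have h1 := hom_eval₂ P (algebraMap F E) τ b
    rw [← aeval_def, hP, map_zero, hb] at h1
    rw [aeval_def, eval₂_map, ← show τ.comp (algebraMap F E) = (algebraMap F E).comp σ from
      RingHom.ext hστ, ← h1]
  have := minpoly.dvd F b h0
  rw [← minpoly.eq_of_irreducible hirr hP] at this
  exact (dvd_mul_right _ _).trans this

theorem evRoot_mk (a : K) (ha : a ^ ℓ = 1) (p : F[X]) :
    evRoot F E a ha (AdjoinRoot.mk _ p) = aeval (algebraMap K E a) p := AdjoinRoot.lift_mk _ _

theorem evRoot_comm (hστ : ∀ x, τ (algebraMap F E x) = algebraMap F E (σ x))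
    (hτK : ∀ a : K, τ (algebraMap K E a) = algebraMap K E a) (a : K) (ha : a ^ ℓ = 1) (r : S F ℓ) :
    τ (evRoot F E a ha r) = evRoot F E a ha (extend σ ℓ r) := by
  obtain ⟨p, rfl⟩ := AdjoinRoot.mk_surjective r
  rw [extend_mk, evRoot_mk, evRoot_mk, aeval_def, aeval_def, hom_eval₂, hτK, eval₂_map,
    show τ.comp (algebraMap F E) = (algebraMap F E).comp σ from RingHom.ext hστ]

/-- The partial evaluation is a ring homomorphism because the evaluation point lies in `K`, which is
fixed by `τ`. -/
theorem evPartial_eq (a : K) (ha : a ^ ℓ = 1)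
    (hcomm : ∀ r, τ (evRoot F E a ha r) = evRoot F E a ha (extend σ ℓ r)) (f : SkewS σ ℓ) :
    evPartial σ τ a ha f = skewMap (evRoot F E a ha) hcomm f := by
  induction f using skewPoly_induction with
  | h_mono k r =>
    rw [skewMap_mono, evPartial, mono, SkewPolynomial.sum_monomial_index]
    · simp
    · simp [mono_zero]
  | h_add f g hf hg =>
    rw [map_add, ← hf, ← hg]
    exact SkewMonoidAlgebra.sum_add_index' (by simp [mono_zero]) (by simp [mono_add])

theorem mem_definingSetAt_iff (hτK : ∀ a : K, τ (algebraMap K E a) = algebraMap K E a) (a : K)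
    (ha : a ^ ℓ = 1) (C : Submodule F (Fin ℓ → Fin m → F)) (β : E) :
    β ∈ definingSetAt σ τ C a ↔
      β ≠ 0 ∧ operator hτK (evPartial σ τ a ha (minimalGenerator σ C)) β = 0 := by
  constructor
  · rintro ⟨hβ, _, _, h⟩
    exact ⟨hβ, (mem_rootIdeal_iff hτK hβ _).1 ((Submodule.Quotient.mk_eq_zero _).1 h)⟩
  · rintro ⟨hβ, h⟩
    exact ⟨hβ, hβ, ha, (Submodule.Quotient.mk_eq_zero _).2 ((mem_rootIdeal_iff hτK hβ _).2 h)⟩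

/-- Evaluation at a root of `P` factors through `F[x] / (P)`, hence maps skew polynomials that are
monic modulo `P` to monic ones of the same degree. -/
theorem monicOfDegree_skewMap_evRoot {a : K} (ha : a ^ ℓ = 1)
    (hcomm : ∀ r, τ (evRoot F E a ha r) = evRoot F E a ha (extend σ ℓ r)) {P : F[X]}
    (hP : P ∣ X ^ ℓ - 1) (hroot : aeval (algebraMap K E a) P = 0) {f : SkewS σ ℓ} {d : ℕ}
    (hd : AdjoinRoot.algHomOfDvd F (X ^ ℓ - 1) P hP (coef f d) = 1)
    (hd' : ∀ k, d < k → AdjoinRoot.algHomOfDvd F (X ^ ℓ - 1) P hP (coef f k) = 0) :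
    MonicOfDegree (skewMap (evRoot F E a ha) hcomm f) d := by
  have hroot' : eval₂ (algebraMap F E) (algebraMap K E a) P = 0 := by rwa [← aeval_def]
  have key : ∀ r : S F ℓ, evRoot F E a ha r =
      AdjoinRoot.lift (algebraMap F E) (algebraMap K E a) hroot'
        (AdjoinRoot.algHomOfDvd F (X ^ ℓ - 1) P hP r) := by
    intro r
    obtain ⟨p, rfl⟩ := AdjoinRoot.mk_surjective r
    rw [evRoot_mk, algHomOfDvd_mk, AdjoinRoot.lift_mk, aeval_def]
  refine ⟨?_, fun k hk => ?_⟩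
  · rw [coef_skewMap, key, hd, map_one]
  · rw [coef_skewMap, key, hd' k hk, map_zero]

end Evaluation

theorem natCast_ne_zero_of_card {F : Type*} [Field F] {p n ℓ : ℕ} [Fact p.Prime]
    (hF : Nat.card F = p ^ n) (hpℓ : ¬ p ∣ ℓ) : (ℓ : F) ≠ 0 := by
  have hp : p.Prime := Fact.out
  have hfin : Finite F := Nat.finite_of_card_ne_zero (by rw [hF]; exact (pow_pos hp.pos n).ne')
  have : Fintype F := Fintype.ofFinite F
  have h0 : (p : F) = 0 := by
    have h := FiniteField.cast_card_eq_zero F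
    rw [← Nat.card_eq_fintype_card, hF, Nat.cast_pow] at h
    exact eq_zero_of_pow_eq_zero h
  intro hℓ
  have hcop : Nat.Coprime p ℓ := (Nat.Prime.coprime_iff_not_dvd hp).2 hpℓ
  have := (Nat.isCoprime_iff_coprime.2 hcop).map (Int.castRingHom F)
  simp [h0, hℓ] at this

end CSC
end
theorem mainTheorem6
    (p e s m ℓ q₀ q : ℕ) [Fact p.Prime] (he : 0 < e) (hs : 0 < s) (hm : 0 < m) (hℓ : 0 < ℓ)
    (hq₀ : q₀ = p ^ e) (hq : q = q₀ ^ s) (hpℓ : ¬ p ∣ ℓ)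
    (F K E : Type*) [Field F] [Field K] [Field E]
    [Algebra F E] [Algebra K E]
    (hF : Nat.card F = q₀ ^ m) (hK : Nat.card K = q) (hE : Nat.card E = q ^ m)
    (hroots : (Polynomial.X ^ ℓ - 1 : Polynomial K).Splits)
    (σ : F →+* F) (hσ : ∀ x, σ x = x ^ q) (τ : E →+* E) (hτ : ∀ x, τ x = x ^ q)
    (C : Submodule F (Fin ℓ → Fin m → F)) (hC : CSC.IsCSC σ C) :
    (∃! g, CSC.IsMinimalGenerator σ C g) ∧
    ∃ V : K → Submodule K E,
      (∀ a : K, a ^ ℓ = 1 → (V a : Set E) = CSC.definingSetAt σ τ C a ∪ {0}) ∧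
      ∀ (t : ℕ) (M : Fin t → Polynomial F) (a : Fin t → K),
        (∀ i, Irreducible (M i)) → Polynomial.X ^ ℓ - 1 = ∏ i, M i →
        (∀ i, Polynomial.aeval (algebraMap K E (a i)) (M i) = 0) →
        (Module.finrank F C : ℤ) =
            ∑ i, ((M i).natDegree : ℤ) * ((m : ℤ) - (Module.finrank K (V (a i)) : ℤ)) ∧
        (Module.finrank F C : ℤ) =
            ((ℓ * m : ℕ) : ℤ) -
              ∑ i, ((M i).natDegree : ℤ) * (Module.finrank K (V (a i)) : ℤ) := by
  classical
  have hp1 : 1 < p := (Fact.out : p.Prime).one_lt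
  have hq1 : 1 < q := by
    rw [hq, hq₀, ← pow_mul]
    exact Nat.one_lt_pow (Nat.mul_pos he hs).ne' hp1
  have hFfin : Finite F := Nat.finite_of_card_ne_zero (by
    rw [hF, hq₀]; exact (pow_pos (pow_pos (by omega) _) _).ne')
  have hKfin : Finite K := Nat.finite_of_card_ne_zero (by omega)
  have hEfin : Finite E := Nat.finite_of_card_ne_zero (by
    rw [hE]; exact (pow_pos (by omega) _).ne')
  have hℓF : (ℓ : F) ≠ 0 :=
    CSC.natCast_ne_zero_of_card (p := p) (n := e * m) (by rw [hF, hq₀, ← pow_mul]) hpℓ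
  have hσm : ∀ x, σ^[m] x = x := fun x => by
    have : Fintype F := Fintype.ofFinite F
    -- `q ^ m` is the `s`-th power of the order of `F`.
    rw [CSC.iterate_frobenius hσ, hq, pow_right_comm, ← hF, Nat.card_eq_fintype_card,
      FiniteField.pow_card_pow]
  have hτK : ∀ a : K, τ (algebraMap K E a) = algebraMap K E a := fun a => by
    have : Fintype K := Fintype.ofFinite K
    rw [hτ, ← map_pow, ← hK, Nat.card_eq_fintype_card, FiniteField.pow_card]
  have hστ : ∀ x, τ (algebraMap F E x) = algebraMap F E (σ x) := fun x => by
    rw [hτ, hσ, map_pow]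
  have hcop : ∀ {t : ℕ} {M : Fin t → Polynomial F}, Polynomial.X ^ ℓ - 1 = ∏ i, M i →
      Pairwise (Function.onFun IsCoprime M) := fun {t M} hM i j hij =>
    CSC.isCoprime_of_mul_dvd_X_pow_sub_one hℓF (by
      rw [hM, ← Finset.mul_prod_erase Finset.univ M (Finset.mem_univ i)]
      exact mul_dvd_mul_left _ (Finset.dvd_prod_of_mem M
        (Finset.mem_erase.2 ⟨hij.symm, Finset.mem_univ j⟩)))
  have hex : ∃! g, CSC.IsMinimalGenerator σ C g := by
    obtain ⟨t, M, hirr, hM⟩ := CSC.exists_factorization (F := F) hℓ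
    have : ∀ i, Fact (Irreducible (M i)) := fun i => ⟨hirr i⟩
    refine CSC.existsUnique_isMinimalGenerator hM (hcop hM) (fun i => ?_) hm hσm hC
    obtain ⟨a, ha⟩ := CSC.exists_root_of_dvd (E := E) hℓ hroots
      (hM ▸ Finset.dvd_prod_of_mem M (Finset.mem_univ i)) (hirr i)
    exact CSC.dvd_map_of_root hστ (hirr i) (hτK a) ha
  obtain ⟨h, hg⟩ : CSC.IsMinimalGenerator σ C (CSC.minimalGenerator σ C) :=
    Classical.epsilon_spec hex.exists
  obtain ⟨V, hV⟩ : ∃ V : K → Submodule K E, ∀ a (ha : a ^ ℓ = 1), V a =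
      LinearMap.ker (CSC.operator hτK (CSC.evPartial σ τ a ha (CSC.minimalGenerator σ C))) :=
    ⟨fun a => if ha : a ^ ℓ = 1 then LinearMap.ker (CSC.operator hτK
      (CSC.evPartial σ τ a ha (CSC.minimalGenerator σ C))) else ⊥, fun a ha => dif_pos ha⟩
  refine ⟨hex, V, fun a ha => ?_, ?_⟩
  · ext β
    rw [hV a ha, Set.mem_union, CSC.mem_definingSetAt_iff hτK a ha, Set.mem_singleton_iff,
      SetLike.mem_coe, LinearMap.mem_ker]
    by_cases hβ : β = 0
    · simp [hβ]
    · simp [hβ]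
  · intro t M a hirr hM hroot
    have : ∀ i, Fact (Irreducible (M i)) := fun i => ⟨hirr i⟩
    have hdvd : ∀ i, M i ∣ Polynomial.X ^ ℓ - 1 := fun i =>
      hM ▸ Finset.dvd_prod_of_mem M (Finset.mem_univ i)
    have hσM : ∀ i, M i ∣ (M i).map σ := fun i =>
      CSC.dvd_map_of_root hστ (hirr i) (hτK (a i)) (hroot i)
    have ha : ∀ i, a i ^ ℓ = 1 := fun i => by
      obtain ⟨Q, hQ⟩ := hdvd i
      have h1 := congrArg (Polynomial.aeval (algebraMap K E (a i))) hQ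
      rw [map_mul, hroot, zero_mul, map_sub, map_pow, map_one, Polynomial.aeval_X, ← map_pow,
        ← map_one (algebraMap K E), sub_eq_zero] at h1
      exact (algebraMap K E).injective h1
    choose d hd hd' using fun i => hg.monic_left (M i) (hdvd i) (hirr i)
    have hVd : ∀ i, d i ≤ m ∧ Module.finrank K (V (a i)) = d i := by
      intro i
      have hcomm := CSC.evRoot_comm hστ hτK (a i) (ha i)
      have hmon := CSC.monicOfDegree_skewMap_evRoot (ha i) hcomm (hdvd i) (hroot i) (hd i) (hd' i)
      have h1 := congrArg (CSC.skewMap (CSC.evRoot F E (a i) (ha i)) hcomm) hg.mul_left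
      have h2 := congrArg (CSC.skewMap (CSC.evRoot F E (a i) (ha i)) hcomm) hg.mul_right
      rw [map_mul, CSC.skewMap_zPowSubOne] at h1 h2
      rw [hV _ (ha i), CSC.evPartial_eq _ _ hcomm]
      exact ⟨(hmon.cofactor hm h2).1, CSC.finrank_ker_operator hτK hq1 hK hE hτ hm hmon h1 h2⟩
    have hdim := CSC.finrank_add_sum_eq hM (hcop hM) hσM hm hℓ hσm hC hg (d := d)
      (fun i => by
        simp only [CSC.MonicOfDegree, CSC.FieldDecomposition.coef_map]
        exact ⟨hd i, hd' i⟩) fun i => (hVd i).1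
    have hdeg : ∑ i, (M i).natDegree = ℓ := by
      rw [← Polynomial.natDegree_prod _ _ fun i _ => (hirr i).ne_zero, ← hM]
      simpa using Polynomial.natDegree_X_pow_sub_C (n := ℓ) (r := (1 : F))
    have hfin : (Module.finrank F C : ℤ) = ((ℓ * m : ℕ) : ℤ) -
        ∑ i, ((M i).natDegree : ℤ) * (d i : ℤ) := by
      rw [← hdim]
      push_cast
      ring
    simp only [(hVd _).2]
    refine ⟨?_, hfin⟩
    have hdeg' : ∑ i, ((M i).natDegree : ℤ) = ℓ := mod_cast hdeg
    rw [hfin, Nat.cast_mul, ← hdeg']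
    simp only [mul_sub, Finset.sum_sub_distrib, Finset.sum_mul]
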